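/- \textbf{Setting.} Let $s\ge 1$. On $\mathbb{R}^{s+1}$ put $px=p_0x_0-\sum_{j=1}^s p_jx_j$, and on $\mathbb{R}^s$ put $px=-\sum_{j=1}^s p_jx_j$. Consider a local relativistic quantum field theory, i.e. an infinite-dimensional complex Hilbert space $\mathcal{H}$ and a net $\mathcal{O}\mapsto\mathfrak{A}(\mathcal{O})\subset B(\mathcal{H})$ of unital $C^*$-algebras (containing the unit $I$ of $B(\mathcal{H})$), attached to the open bounded sets $\mathcal{O}\subset\mathbb{R}^{s+1}$, such that: $\mathfrak{A}(\mathcal{O}_1)\subset\mathfrak{A}(\mathcal{O}_2)$ if $\mathcal{O}_1\subset\mathcal{O}_2$; $\mathfrak{A}(\mathcal{O}_1)$ and $\mathfrak{A}(\mathcal{O}_2)$ commute if $\mathcal{O}_1,\mathcal{O}_2$ are spacelike separated; the norm closure $\mathfrak{A}$ of $\bigcup_{\mathcal{O}}\mathfrak{A}(\mathcal{O})$ acts irreducibly on $\mathcal{H}$; and there is a strongly continuous unitary representation $U$ of $\mathbb{R}^{s+1}$ on $\mathcal{H}$ whose joint spectrum lies in the closed forward lightcone, such that $\alpha_x(\,\cdot\,)=U(x)\,\cdot\,U(x)^*$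 satisfies $\alpha_x(\mathfrak{A}(\mathcal{O}))=\mathfrak{A}(\mathcal{O}+x)$ and $x\mapsto\alpha_x(A)$ is norm continuous for every $A\in\mathfrak{A}$. Suppose that there is a unit vector $\Omega\in\mathcal{H}$ with $U(x)\Omega=\Omega$ for all $x$, and set $\omega_0(A)=(\Omega|A\Omega)$. Let $\mathfrak{A}_*=B(\mathcal{H})_*\subset\mathfrak{A}^*$ be the space of (restrictions to $\mathfrak{A}$ of) normal functionals, with the transposed action $\alpha_x^*\varphi=\varphi\circ\alpha_x$, and let $\beta_{\vec x}=\alpha_{(0,\vec x)}$, $\vec x\in\mathbb{R}^s$. Fix $0<\varepsilon<1$ and put $K_L=[-L^\varepsilon,L^\varepsilon]\times[-L,L]^s$ for $\alpha$ ($d=s+1$) and $K_L=[-L,L]^s$ for $\beta$ ($d=s$). \textbf{Spectral notions} (written for $\alpha$; likewise for $\beta$). For $\varphi\in\mathfrak{A}_*$, $A\in\mathfrak{A}$ let $\varphi(\widetilde{A}(p))=(2\pi)^{-d/2}\int d^dx\,e^{-ipx}\varphi(\alpha_x(A))$, a tempered distribution in $p$. Put $\mathrm{Sp}\,\alpha=\overline{\bigcup_{A\in\mathfrak{A},\,\varphi\in\mathfrak{A}_*}\mathrm{supp}\,\varphi(\widetilde{A}(\cdot))}$;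 $\widetilde{\mathfrak{A}}(\{q\})=\{A\in\mathfrak{A}\mid \mathrm{supp}\,\varphi(\widetilde{A}(\cdot))\subset\{q\}\ \forall\varphi\in\mathfrak{A}_*\}$; $\mathfrak{A}_{\mathrm{pp}}$ is the norm closure of the span of the sets $\widetilde{\mathfrak{A}}(\{q\})$, $q\in\mathrm{Sp}\,\alpha$; $$\mathfrak{A}_{\mathrm{c}}=\Big\{A\in\mathfrak{A}\ \Big|\ \lim_{L\to\infty}\frac{1}{|K_L|}\int_{K_L}e^{-iqx}\varphi(\alpha_x(A))\,d^dx=0\ \ \forall q\in\mathbb{R}^d,\ \varphi\in\mathfrak{A}_*\Big\};$$ and $\mathrm{Sp}_{\mathrm{c}}\alpha=\overline{\bigcup_{A\in\mathfrak{A}_{\mathrm{c}},\,\varphi\in\mathfrak{A}_*}\mathrm{supp}\,\varphi(\widetilde{A}(\cdot))}$. The objects $\mathfrak{A}_{*,\mathrm{pp}}$, $\mathfrak{A}_{*,\mathrm{c}}$, $\mathrm{Sp}_{\mathrm{c}}\alpha^*$ are defined in the same way for the action $\alpha^*$ on $\mathfrak{A}_*$, with the roles of $\mathfrak{A}$ and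 $\mathfrak{A}_*$ exchanged. \textbf{Theorem.} $\ker\omega_0\subset\mathfrak{A}_{\mathrm{c}}$ and, consequently, (a) $\mathfrak{A}=\mathfrak{A}_{\mathrm{pp}}\oplus\mathfrak{A}_{\mathrm{c}}$, where $\mathfrak{A}_{\mathrm{pp}}=\mathrm{Span}\{I\}$ and $\mathfrak{A}_{\mathrm{c}}=\ker\omega_0$; (b) $\mathfrak{A}_*=\mathfrak{A}_{*,\mathrm{pp}}\oplus\mathfrak{A}_{*,\mathrm{c}}$, where $\mathfrak{A}_{*,\mathrm{pp}}=\mathrm{Span}\{\omega_0\}$ and $\mathfrak{A}_{*,\mathrm{c}}=\ker I=\{\varphi\in\mathfrak{A}_*\mid\varphi(I)=0\}$; (c) $\mathrm{Sp}_{\mathrm{c}}\alpha=\mathrm{Sp}_{\mathrm{c}}\alpha^*$. The same statements hold for the group $\beta$ of space translations. -/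

import Mathlib

open MeasureTheory Filter Topology
open scoped ContDiff

noncomputable section

/-! ### Fourier transforms and supports -/

/-- The Fourier transform `(2π)^{-d/2} ∫ dx e^{-ipx} F(x)` of a bounded continuous function `F`,
as a tempered distribution in `p`, evaluated on the test function `g`; `px` is `B p x`. -/
def fourierPairing {d : ℕ} (B : LinearMap.BilinForm ℝ (Fin d → ℝ)) (F g : (Fin d → ℝ) → ℂ) : ℂ :=
  (((2 * Real.pi) ^ (-(d : ℝ) / 2) : ℝ) : ℂ) *
    ∫ x : Fin d → ℝ, F x * ∫ p : Fin d → ℝ, Complex.exp (-Complex.I * (B p x : ℝ)) * g p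

/-- The support of the distribution `fourierPairing B F`: the points all of whose open
neighbourhoods carry a test function on which the distribution does not vanish. -/
def fourierSupport {d : ℕ} (B : LinearMap.BilinForm ℝ (Fin d → ℝ)) (F : (Fin d → ℝ) → ℂ) :
    Set (Fin d → ℝ) :=
  {p | ∀ V : Set (Fin d → ℝ), IsOpen V → p ∈ V →
    ∃ g : (Fin d → ℝ) → ℂ, ContDiff ℝ ∞ g ∧ HasCompactSupport g ∧ tsupport g ⊆ V ∧
      fourierPairing B F g ≠ 0}

/-! ### Spectral theory of groups of isometries -/

/-- A group of isometries `x ↦ act x` of `E`, indexed by `ℝ^d`, together with a space `F` which is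
paired with `E`, such that all functions `x ↦ ⟨φ, act x A⟩` are continuous. -/
structure IsometryGroup (d : ℕ) (E F : Type*) [NormedAddCommGroup E] [NormedSpace ℂ E]
    [NormedAddCommGroup F] [NormedSpace ℂ F] where
  act : (Fin d → ℝ) → E →ₗᵢ[ℂ] E
  act_zero : ∀ A, act 0 A = A
  act_add : ∀ x y A, act (x + y) A = act x (act y A)
  pairing : F →ₗ[ℂ] E →ₗ[ℂ] ℂ
  norm_pairing_le : ∀ φ A, ‖pairing φ A‖ ≤ ‖φ‖ * ‖A‖
  continuous_pairing : ∀ φ A, Continuous fun x => pairing φ (act x A)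

namespace IsometryGroup

variable {d : ℕ} {E F : Type*} [NormedAddCommGroup E] [NormedSpace ℂ E]
    [NormedAddCommGroup F] [NormedSpace ℂ F]

/-- The Arveson spectrum of the restriction of the group to a subspace `S`. -/
def spectrumOn (α : IsometryGroup d E F) (B : LinearMap.BilinForm ℝ (Fin d → ℝ))
    (S : Submodule ℂ E) : Set (Fin d → ℝ) :=
  closure (⋃ A ∈ S, ⋃ φ : F, fourierSupport B fun x => α.pairing φ (α.act x A))

/-- The Arveson spectrum. -/
def spectrum (α : IsometryGroup d E F) (B : LinearMap.BilinForm ℝ (Fin d → ℝ)) :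
    Set (Fin d → ℝ) :=
  α.spectrumOn B ⊤

/-- The spectral subspace of a (closed) set `Δ`. -/
def spectralSubspace (α : IsometryGroup d E F) (B : LinearMap.BilinForm ℝ (Fin d → ℝ))
    (Δ : Set (Fin d → ℝ)) : Set E :=
  {A | ∀ φ : F, fourierSupport B (fun x => α.pairing φ (α.act x A)) ⊆ Δ}

/-- The pure-point subspace. -/
def purePointSubspace (α : IsometryGroup d E F) (B : LinearMap.BilinForm ℝ (Fin d → ℝ)) :
    Submodule ℂ E :=
  (Submodule.span ℂ (⋃ q ∈ α.spectrum B, α.spectralSubspace B {q})).topologicalClosure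

/-- The mean of `x ↦ e^{-iqx} ⟨φ, act x A⟩` over the cuboid centred at zero whose half edge
lengths are the entries of `l`. -/
def mean (α : IsometryGroup d E F) (B : LinearMap.BilinForm ℝ (Fin d → ℝ)) (l q : Fin d → ℝ)
    (φ : F) (A : E) : ℂ :=
  (((volume (Set.Icc (-l) l)).toReal⁻¹ : ℝ) : ℂ) *
    ∫ x in Set.Icc (-l) l, Complex.exp (-Complex.I * (B q x : ℝ)) * α.pairing φ (α.act x A)

theorem integrableOn_mean (α : IsometryGroup d E F) (B : LinearMap.BilinForm ℝ (Fin d → ℝ))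
    (l q : Fin d → ℝ) (φ : F) (A : E) :
    IntegrableOn (fun x => Complex.exp (-Complex.I * (B q x : ℝ)) * α.pairing φ (α.act x A))
      (Set.Icc (-l) l) := by
  have h : Continuous fun x => B q x := (B q).continuous_of_finiteDimensional
  have h' := α.continuous_pairing φ A
  exact (Continuous.continuousOn (by fun_prop)).integrableOn_compact isCompact_Icc

/-- The continuous subspace, with respect to the family of cuboids centred at zero with half edge
lengths `l L`, as `L → ∞`. -/
def continuousSubspace (α : IsometryGroup d E F) (B : LinearMap.BilinForm ℝ (Fin d → ℝ))
    (l : ℝ → Fin d → ℝ) : Submodule ℂ E where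
  carrier := {A | ∀ (q : Fin d → ℝ) (φ : F),
    Tendsto (fun L : ℝ => α.mean B (l L) q φ A) atTop (𝓝 0)}
  zero_mem' := by
    intro q φ
    simp [mean]
  add_mem' := by
    intro a b ha hb q φ
    have h := (ha q φ).add (hb q φ)
    rw [add_zero] at h
    refine h.congr fun L => ?_
    simp only [mean]
    rw [← mul_add, ← integral_add (α.integrableOn_mean B _ q φ a) (α.integrableOn_mean B _ q φ b)]
    simp only [map_add, mul_add]
  smul_mem' := by
    intro c a ha q φ
    have h := (ha q φ).const_mul c
    rw [mul_zero] at h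
    refine h.congr fun L => ?_
    simp only [mean]
    rw [mul_left_comm, ← integral_const_mul]
    simp only [map_smul, smul_eq_mul, mul_left_comm]

/-- The continuous spectrum. -/
def continuousSpectrum (α : IsometryGroup d E F) (B : LinearMap.BilinForm ℝ (Fin d → ℝ))
    (l : ℝ → Fin d → ℝ) : Set (Fin d → ℝ) :=
  α.spectrumOn B (α.continuousSubspace B l)

/-- The subgroup obtained by restriction along a linear map of the parameter spaces. -/
def restrict {k : ℕ} (α : IsometryGroup d E F) (j : (Fin k → ℝ) →ₗ[ℝ] (Fin d → ℝ)) :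
    IsometryGroup k E F where
  act x := α.act (j x)
  act_zero A := by rw [map_zero, α.act_zero]
  act_add x y A := by rw [map_add, α.act_add]
  pairing := α.pairing
  norm_pairing_le := α.norm_pairing_le
  continuous_pairing φ A :=
    (α.continuous_pairing φ A).comp j.continuous_of_finiteDimensional

/-- The group of isometries `act` of `E`, considered with a subspace `N` of the dual. -/
def ofDualSubspace (act : (Fin d → ℝ) → E →ₗᵢ[ℂ] E) (h0 : ∀ A, act 0 A = A)
    (hadd : ∀ x y A, act (x + y) A = act x (act y A))
    (hcont : ∀ A, Continuous fun x => act x A) (N : Submodule ℂ (StrongDual ℂ E)) :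
    IsometryGroup d E N where
  act := act
  act_zero := h0
  act_add := hadd
  pairing := (ContinuousLinearMap.coeLM ℂ).comp N.subtype
  norm_pairing_le φ A := (φ : StrongDual ℂ E).le_opNorm A
  continuous_pairing φ A := (φ : StrongDual ℂ E).continuous.comp (hcont A)

theorem norm_comp_act (act : (Fin d → ℝ) → E →ₗᵢ[ℂ] E) (h0 : ∀ A, act 0 A = A)
    (hadd : ∀ x y A, act (x + y) A = act x (act y A)) (x : Fin d → ℝ) (φ : StrongDual ℂ E) :
    ‖φ.comp (act x).toContinuousLinearMap‖ = ‖φ‖ := by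
  refine le_antisymm ?_ ?_
  · refine ContinuousLinearMap.opNorm_le_bound _ (norm_nonneg φ) fun A => ?_
    have h := φ.le_opNorm (act x A)
    rwa [LinearIsometry.norm_map] at h
  · refine ContinuousLinearMap.opNorm_le_bound _
      (norm_nonneg (φ.comp (act x).toContinuousLinearMap)) fun A => ?_
    have h := (φ.comp (act x).toContinuousLinearMap).le_opNorm (act (-x) A)
    have e : act x (act (-x) A) = A := by rw [← hadd, add_neg_cancel, h0]
    rw [LinearIsometry.norm_map] at h
    change ‖φ (act x (act (-x) A))‖ ≤ _ at h
    rwa [e] at h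

/-- The transposed action `φ ↦ φ ∘ act x` on an invariant subspace `N` of the dual of `E`, with the
roles of `E` and `N` exchanged. -/
def transpose (act : (Fin d → ℝ) → E →ₗᵢ[ℂ] E) (h0 : ∀ A, act 0 A = A)
    (hadd : ∀ x y A, act (x + y) A = act x (act y A))
    (hcont : ∀ A, Continuous fun x => act x A) (N : Submodule ℂ (StrongDual ℂ E))
    (hN : ∀ x, ∀ φ ∈ N, φ.comp (act x).toContinuousLinearMap ∈ N) :
    IsometryGroup d N E where
  act x :=
    { toFun := fun φ => ⟨(φ : StrongDual ℂ E).comp (act x).toContinuousLinearMap, hN x φ φ.2⟩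
      map_add' := fun _ _ => rfl
      map_smul' := fun _ _ => rfl
      norm_map' := fun φ => norm_comp_act act h0 hadd x (φ : StrongDual ℂ E) }
  act_zero φ := by
    refine Subtype.ext (ContinuousLinearMap.ext fun A => ?_)
    change (φ : StrongDual ℂ E) (act 0 A) = (φ : StrongDual ℂ E) A
    rw [h0]
  act_add x y φ := by
    refine Subtype.ext (ContinuousLinearMap.ext fun A => ?_)
    change (φ : StrongDual ℂ E) (act (x + y) A) = (φ : StrongDual ℂ E) (act y (act x A))
    rw [add_comm, hadd]
  pairing := ((ContinuousLinearMap.coeLM ℂ).comp N.subtype).flip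
  norm_pairing_le A φ := by
    rw [mul_comm]
    exact (φ : StrongDual ℂ E).le_opNorm A
  continuous_pairing A φ := (φ : StrongDual ℂ E).continuous.comp (hcont A)

end IsometryGroup

/-! ### Minkowski space -/

/-- The Minkowski product `p₀x₀ - ∑ pⱼxⱼ` on `ℝ^{s+1}`; the coordinate `0` is time. -/
def minkowskiForm (s : ℕ) : LinearMap.BilinForm ℝ (Fin (s + 1) → ℝ) :=
  LinearMap.mk₂ ℝ (fun p x => p 0 * x 0 - ∑ j : Fin s, p j.succ * x j.succ)
    (fun p p' x => by simp only [Pi.add_apply, add_mul, Finset.sum_add_distrib]; ring)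
    (fun c p x => by simp only [Pi.smul_apply, smul_eq_mul, mul_sub, Finset.mul_sum, mul_assoc])
    (fun p x x' => by simp only [Pi.add_apply, mul_add, Finset.sum_add_distrib]; ring)
    (fun c p x => by
      simp only [Pi.smul_apply, smul_eq_mul, mul_sub, Finset.mul_sum, mul_left_comm])

/-- The restriction `-∑ pⱼxⱼ` of the Minkowski product to space. -/
def spaceForm (s : ℕ) : LinearMap.BilinForm ℝ (Fin s → ℝ) :=
  LinearMap.mk₂ ℝ (fun p x => -∑ j : Fin s, p j * x j)
    (fun p p' x => by simp only [Pi.add_apply, add_mul, Finset.sum_add_distrib]; ring)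
    (fun c p x => by simp only [Pi.smul_apply, smul_eq_mul, mul_neg, Finset.mul_sum, mul_assoc])
    (fun p x x' => by simp only [Pi.add_apply, mul_add, Finset.sum_add_distrib]; ring)
    (fun c p x => by
      simp only [Pi.smul_apply, smul_eq_mul, mul_neg, Finset.mul_sum, mul_left_comm])

/-- The embedding `x ↦ (0, x)` of space into spacetime. -/
def spaceEmbedding (s : ℕ) : (Fin s → ℝ) →ₗ[ℝ] (Fin (s + 1) → ℝ) where
  toFun x := Fin.cons 0 x
  map_add' x y := by
    funext i
    refine Fin.cases ?_ (fun j => ?_) i <;> simp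
  map_smul' c x := by
    funext i
    refine Fin.cases ?_ (fun j => ?_) i <;> simp

/-- The closed forward lightcone. -/
def closedForwardCone (s : ℕ) : Set (Fin (s + 1) → ℝ) :=
  {p | 0 ≤ p 0 ∧ 0 ≤ minkowskiForm s p p}

/-- Every point of `O₁` is spacelike to every point of `O₂`. -/
def SpacelikeSeparated {s : ℕ} (O₁ O₂ : Set (Fin (s + 1) → ℝ)) : Prop :=
  ∀ x ∈ O₁, ∀ y ∈ O₂, minkowskiForm s (x - y) (x - y) < 0

/-- The half edge lengths of `[-L^ε, L^ε] × [-L, L]^s`. -/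
def spacetimeEdges (s : ℕ) (ε L : ℝ) : Fin (s + 1) → ℝ := Fin.cons (L ^ ε) fun _ => L

/-- The half edge lengths of `[-L, L]^s`. -/
def spaceEdges (s : ℕ) (L : ℝ) : Fin s → ℝ := fun _ => L

/-! ### Operators on a Hilbert space -/

section Operators

variable {H : Type*} [NormedAddCommGroup H] [InnerProductSpace ℂ H] [CompleteSpace H]

/-- The operators in `M` leave no closed subspace invariant apart from `0` and `H`. -/
def ActsIrreducibly (M : StarSubalgebra ℂ (H →L[ℂ] H)) : Prop :=
  ∀ W : Submodule ℂ H, IsClosed (W : Set H) → (∀ A ∈ M, ∀ v ∈ W, A v ∈ W) → W = ⊥ ∨ W = ⊤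

/-- The restrictions to `M` of the elements of the predual of `B(H)`, that is the functionals
`A ↦ Tr (ρ A)` with the trace-class operators `ρ = ∑ |χₙ⟩⟨ψₙ|`, `∑ ‖ψₙ‖ ‖χₙ‖ < ∞`. -/
def normalFunctionals (M : StarSubalgebra ℂ (H →L[ℂ] H)) : Submodule ℂ (StrongDual ℂ M) where
  carrier := {φ | ∃ ψ χ : ℕ → H, (Summable fun n => ‖ψ n‖ * ‖χ n‖) ∧
    ∀ A : M, HasSum (fun n => inner ℂ (ψ n) ((A : H →L[ℂ] H) (χ n))) (φ A)}
  zero_mem' := ⟨0, 0, by simp, fun A => by simp⟩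
  add_mem' := by
    rintro φ φ' ⟨ψ, χ, hs, hφ⟩ ⟨ψ', χ', hs', hφ'⟩
    let e := Equiv.natSumNatEquivNat
    refine ⟨fun n => Sum.elim ψ ψ' (e.symm n), fun n => Sum.elim χ χ' (e.symm n), ?_, fun A => ?_⟩
    · refine (e.symm.summable_iff (f := fun i : ℕ ⊕ ℕ =>
        ‖Sum.elim ψ ψ' i‖ * ‖Sum.elim χ χ' i‖)).2 ?_
      exact Summable.sum _ (by simpa [Function.comp_def] using hs)
        (by simpa [Function.comp_def] using hs')
    · refine (e.symm.hasSum_iff (f := fun i : ℕ ⊕ ℕ =>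
        inner ℂ (Sum.elim ψ ψ' i) ((A : H →L[ℂ] H) (Sum.elim χ χ' i)))).2 ?_
      exact HasSum.sum (by simpa [Function.comp_def] using hφ A)
        (by simpa [Function.comp_def] using hφ' A)
  smul_mem' := by
    rintro c φ ⟨ψ, χ, hs, hφ⟩
    refine ⟨ψ, fun n => c • χ n, ?_, fun A => ?_⟩
    · refine (hs.mul_left ‖c‖).congr fun n => ?_
      rw [norm_smul]; ring
    · simpa [inner_smul_right] using (hφ A).mul_left c

/-- The functional `A ↦ (Ω | A Ω)` on `M`. -/
def vectorFunctional (M : StarSubalgebra ℂ (H →L[ℂ] H)) (Ω : H) : StrongDual ℂ M :=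
  LinearMap.mkContinuous
    { toFun := fun A : M => inner ℂ Ω ((A : H →L[ℂ] H) Ω)
      map_add' := fun A B => by simp
      map_smul' := fun c A => by simp }
    (‖Ω‖ * ‖Ω‖) (fun A => by
      calc ‖inner ℂ Ω ((A : H →L[ℂ] H) Ω)‖ ≤ ‖Ω‖ * ‖(A : H →L[ℂ] H) Ω‖ := norm_inner_le_norm _ _
        _ ≤ ‖Ω‖ * (‖(A : H →L[ℂ] H)‖ * ‖Ω‖) := by gcongr; exact (A : H →L[ℂ] H).le_opNorm Ω
        _ = ‖Ω‖ * ‖Ω‖ * ‖A‖ := by rw [show ‖A‖ = ‖(A : H →L[ℂ] H)‖ from rfl]; ring)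

theorem vectorFunctional_mem (M : StarSubalgebra ℂ (H →L[ℂ] H)) (Ω : H) :
    vectorFunctional M Ω ∈ normalFunctionals M := by
  refine ⟨Pi.single 0 Ω, Pi.single 0 Ω, ?_, fun A => ?_⟩
  · refine summable_of_ne_finset_zero (s := {0}) fun n hn => ?_
    have : n ≠ 0 := by simpa using hn
    simp [Pi.single_eq_of_ne this]
  · have h := hasSum_single (f := fun n => inner ℂ ((Pi.single 0 Ω : ℕ → H) n)
      ((A : H →L[ℂ] H) ((Pi.single 0 Ω : ℕ → H) n))) 0 fun n hn => by
        simp [Pi.single_eq_of_ne hn]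
    simpa [vectorFunctional] using h

/-- The joint spectrum of the generators of a strongly continuous unitary representation
`U(x) = ∫ e^{ipx} dE(p)` of the translations, i.e. the support of the spectral measure `E`: the
Fourier transform of `x ↦ (ψ | U(x) χ)` is a multiple of the measure `(ψ | E(·) χ)`. -/
def jointSpectrum {s : ℕ} (U : (Fin (s + 1) → ℝ) → unitary (H →L[ℂ] H)) :
    Set (Fin (s + 1) → ℝ) :=
  closure (⋃ ψ : H, ⋃ χ : H,
    fourierSupport (minkowskiForm s) fun x => inner ℂ ψ ((U x : H →L[ℂ] H) χ))

end Operators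

/-! ### Local nets and quantum field theories -/

/-- A net of unital C*-algebras of operators on `H`, attached to the open bounded regions of
`ℝ^{s+1}`, which satisfies isotony and locality. Only the values of `net` on open bounded sets are
meaningful. -/
structure LocalNet (s : ℕ) (H : Type*) [NormedAddCommGroup H] [InnerProductSpace ℂ H]
    [CompleteSpace H] where
  net : Set (Fin (s + 1) → ℝ) → StarSubalgebra ℂ (H →L[ℂ] H)
  isClosed_net : ∀ O, IsOpen O → Bornology.IsBounded O → IsClosed (net O : Set (H →L[ℂ] H))
  isotony : ∀ O₁ O₂, IsOpen O₁ → Bornology.IsBounded O₁ → IsOpen O₂ → Bornology.IsBounded O₂ →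
    O₁ ⊆ O₂ → net O₁ ≤ net O₂
  locality : ∀ O₁ O₂, IsOpen O₁ → Bornology.IsBounded O₁ → IsOpen O₂ → Bornology.IsBounded O₂ →
    SpacelikeSeparated O₁ O₂ → ∀ A ∈ net O₁, ∀ B ∈ net O₂, A * B = B * A

namespace LocalNet

variable {s : ℕ} {H : Type*} [NormedAddCommGroup H] [InnerProductSpace ℂ H] [CompleteSpace H]

theorem exists_common (N : LocalNet s H) {A B : H →L[ℂ] H}
    (hA : ∃ O, IsOpen O ∧ Bornology.IsBounded O ∧ A ∈ N.net O)
    (hB : ∃ O, IsOpen O ∧ Bornology.IsBounded O ∧ B ∈ N.net O) :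
    ∃ O, IsOpen O ∧ Bornology.IsBounded O ∧ A ∈ N.net O ∧ B ∈ N.net O := by
  obtain ⟨O₁, h₁, b₁, a₁⟩ := hA
  obtain ⟨O₂, h₂, b₂, a₂⟩ := hB
  exact ⟨O₁ ∪ O₂, h₁.union h₂, b₁.union b₂,
    N.isotony _ _ h₁ b₁ (h₁.union h₂) (b₁.union b₂) Set.subset_union_left a₁,
    N.isotony _ _ h₂ b₂ (h₁.union h₂) (b₁.union b₂) Set.subset_union_right a₂⟩

/-- The `*`-algebra of local operators: the union of all local algebras. -/
def localOperators (N : LocalNet s H) : StarSubalgebra ℂ (H →L[ℂ] H) where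
  carrier := {A | ∃ O, IsOpen O ∧ Bornology.IsBounded O ∧ A ∈ N.net O}
  mul_mem' hA hB := by
    obtain ⟨O, h, b, a, a'⟩ := N.exists_common hA hB
    exact ⟨O, h, b, mul_mem a a'⟩
  add_mem' hA hB := by
    obtain ⟨O, h, b, a, a'⟩ := N.exists_common hA hB
    exact ⟨O, h, b, add_mem a a'⟩
  algebraMap_mem' c := ⟨∅, isOpen_empty, Bornology.isBounded_empty, algebraMap_mem _ c⟩
  star_mem' := by
    rintro A ⟨O, h, b, a⟩
    exact ⟨O, h, b, star_mem a⟩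

/-- The algebra of observables: the norm closure of the local operators. -/
def observables (N : LocalNet s H) : StarSubalgebra ℂ (H →L[ℂ] H) :=
  N.localOperators.topologicalClosure

end LocalNet

/-- A local relativistic quantum field theory on `ℝ^{s+1}`. -/
structure QuantumFieldTheory (s : ℕ) (H : Type*) [NormedAddCommGroup H] [InnerProductSpace ℂ H]
    [CompleteSpace H] extends LocalNet s H where
  infinite_dimensional : ¬ FiniteDimensional ℂ H
  irreducible : ActsIrreducibly toLocalNet.observables
  U : (Fin (s + 1) → ℝ) → unitary (H →L[ℂ] H)
  U_add : ∀ x y, U (x + y) = U x * U y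
  U_continuous : ∀ v : H, Continuous fun x => (U x : H →L[ℂ] H) v
  spectrum_condition : jointSpectrum U ⊆ closedForwardCone s
  /-- `U(x) 𝔄(O) U(x)* = 𝔄(O + x)`. -/
  covariance : ∀ x O, IsOpen O → Bornology.IsBounded O →
    (fun A => (U x : H →L[ℂ] H) * A * star (U x : H →L[ℂ] H)) '' (net O : Set (H →L[ℂ] H)) =
      (net ((fun y => y + x) '' O) : Set (H →L[ℂ] H))
  translations_continuous : ∀ A ∈ toLocalNet.observables,
    Continuous fun x => (U x : H →L[ℂ] H) * A * star (U x : H →L[ℂ] H)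

namespace QuantumFieldTheory

variable {s : ℕ} {H : Type*} [NormedAddCommGroup H] [InnerProductSpace ℂ H] [CompleteSpace H]

/-- The algebra of observables `𝔄`. -/
abbrev algebra (Q : QuantumFieldTheory s H) : StarSubalgebra ℂ (H →L[ℂ] H) :=
  Q.toLocalNet.observables

/-- The space `𝔄_* = B(H)_*`, as a subspace of the dual of `𝔄`. -/
abbrev predual (Q : QuantumFieldTheory s H) : Submodule ℂ (StrongDual ℂ Q.algebra) :=
  normalFunctionals Q.algebra

theorem conj_mem (Q : QuantumFieldTheory s H) (x : Fin (s + 1) → ℝ) {A : H →L[ℂ] H}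
    (hA : A ∈ Q.algebra) :
    (Q.U x : H →L[ℂ] H) * A * star (Q.U x : H →L[ℂ] H) ∈ Q.algebra := by
  have hc : Continuous fun A : H →L[ℂ] H =>
      (Q.U x : H →L[ℂ] H) * A * star (Q.U x : H →L[ℂ] H) := by fun_prop
  refine map_mem_closure (f := fun A : H →L[ℂ] H =>
    (Q.U x : H →L[ℂ] H) * A * star (Q.U x : H →L[ℂ] H)) hc hA ?_
  rintro B ⟨O, h, b, a⟩
  refine ⟨(fun y => y + x) '' O, (Homeomorph.addRight x).isOpenMap O h, ?_, ?_⟩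
  · exact (isometry_add_right x).lipschitz.isBounded_image b
  · have hm : (Q.U x : H →L[ℂ] H) * B * star (Q.U x : H →L[ℂ] H) ∈
        (fun A => (Q.U x : H →L[ℂ] H) * A * star (Q.U x : H →L[ℂ] H)) ''
          (Q.net O : Set (H →L[ℂ] H)) := ⟨B, a, rfl⟩
    rwa [Q.covariance x O h b] at hm

/-- The translation automorphism `α_x(A) = U(x) A U(x)*` of `𝔄`. -/
def translation (Q : QuantumFieldTheory s H) (x : Fin (s + 1) → ℝ) :
    Q.algebra →ₗᵢ[ℂ] Q.algebra where
  toFun A := ⟨(Q.U x : H →L[ℂ] H) * (A : H →L[ℂ] H) * star (Q.U x : H →L[ℂ] H), Q.conj_mem x A.2⟩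
  map_add' A B := by
    ext1
    simp [mul_add, add_mul]
  map_smul' c A := by
    ext1
    simp
  norm_map' A := by
    change ‖(Q.U x : H →L[ℂ] H) * (A : H →L[ℂ] H) * star (Q.U x : H →L[ℂ] H)‖ =
      ‖(A : H →L[ℂ] H)‖
    rw [CStarRing.norm_mul_mem_unitary _ (Unitary.star_mem (Q.U x).2),
      CStarRing.norm_coe_unitary_mul]

theorem translation_zero (Q : QuantumFieldTheory s H) (A : Q.algebra) :
    Q.translation 0 A = A := by
  have h : Q.U 0 = 1 := by
    have := Q.U_add 0 0
    rw [add_zero] at this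
    exact left_eq_mul.1 this
  ext1
  simp [translation, h]

theorem translation_add (Q : QuantumFieldTheory s H) (x y : Fin (s + 1) → ℝ) (A : Q.algebra) :
    Q.translation (x + y) A = Q.translation x (Q.translation y A) := by
  ext1
  simp [translation, Q.U_add, mul_assoc]

theorem translation_continuous (Q : QuantumFieldTheory s H) (A : Q.algebra) :
    Continuous fun x => Q.translation x A :=
  (Q.translations_continuous A A.2).subtype_mk _

theorem predual_invariant (Q : QuantumFieldTheory s H) (x : Fin (s + 1) → ℝ) :
    ∀ φ ∈ Q.predual, φ.comp (Q.translation x).toContinuousLinearMap ∈ Q.predual := by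
  rintro φ ⟨ψ, χ, hs, hφ⟩
  refine ⟨fun n => star (Q.U x : H →L[ℂ] H) (ψ n), fun n => star (Q.U x : H →L[ℂ] H) (χ n),
    ?_, fun A => ?_⟩
  · have h : ∀ v, ‖star (Q.U x : H →L[ℂ] H) v‖ = ‖v‖ := fun v => by
      simpa using ContinuousLinearMap.norm_map_of_mem_unitary (Unitary.star_mem (Q.U x).2) v
    simpa [h] using hs
  · have e : ∀ n, inner ℂ (star (Q.U x : H →L[ℂ] H) (ψ n))
        ((A : H →L[ℂ] H) (star (Q.U x : H →L[ℂ] H) (χ n))) =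
        inner ℂ (ψ n) ((Q.translation x A : H →L[ℂ] H) (χ n)) := fun n => by
      rw [ContinuousLinearMap.star_eq_adjoint, ContinuousLinearMap.adjoint_inner_left]
      rfl
    simp only [e]
    exact hφ (Q.translation x A)

/-- The group `α` of spacetime translation automorphisms of `𝔄`, with `𝔄_* = B(H)_*`. -/
def spacetimeTranslations (Q : QuantumFieldTheory s H) :
    IsometryGroup (s + 1) Q.algebra Q.predual :=
  IsometryGroup.ofDualSubspace Q.translation Q.translation_zero Q.translation_add
    Q.translation_continuous Q.predual

/-- The transposed action `α*` on `𝔄_*`. -/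
def dualSpacetimeTranslations (Q : QuantumFieldTheory s H) :
    IsometryGroup (s + 1) Q.predual Q.algebra :=
  IsometryGroup.transpose Q.translation Q.translation_zero Q.translation_add
    Q.translation_continuous Q.predual Q.predual_invariant

/-- The group `β_x = α_{(0, x)}` of space translation automorphisms. -/
def spaceTranslations (Q : QuantumFieldTheory s H) : IsometryGroup s Q.algebra Q.predual :=
  Q.spacetimeTranslations.restrict (spaceEmbedding s)

/-- The transposed action `β*` on `𝔄_*`. -/
def dualSpaceTranslations (Q : QuantumFieldTheory s H) : IsometryGroup s Q.predual Q.algebra :=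
  Q.dualSpacetimeTranslations.restrict (spaceEmbedding s)

/-- A vacuum vector: a unit vector which is invariant under the translations. -/
def IsVacuumVector (Q : QuantumFieldTheory s H) (Ω : H) : Prop :=
  ‖Ω‖ = 1 ∧ ∀ x, (Q.U x : H →L[ℂ] H) Ω = Ω

/-- The functional `ω₀ = (Ω | · Ω)` as an element of `𝔄_*`. -/
def vacuumState (Q : QuantumFieldTheory s H) (Ω : H) : Q.predual :=
  ⟨vectorFunctional Q.algebra Ω, vectorFunctional_mem Q.algebra Ω⟩

/-- The kernel of `ω₀` in `𝔄`. -/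
def kerVacuum (Q : QuantumFieldTheory s H) (Ω : H) : Submodule ℂ Q.algebra :=
  LinearMap.ker ((Q.vacuumState Ω : StrongDual ℂ Q.algebra) : Q.algebra →ₗ[ℂ] ℂ)

/-- The kernel of the unit `I` in `𝔄_*`, i.e. the functionals which vanish on `I`. -/
def kerUnit (Q : QuantumFieldTheory s H) : Submodule ℂ Q.predual :=
  LinearMap.ker (((ContinuousLinearMap.coeLM ℂ).comp Q.predual.subtype).flip (1 : Q.algebra))

end QuantumFieldTheory

end

/-!
For an observable `A` in the kernel of `ω₀`, consider the averages of `e^{-iqx} α_x(A)` over the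
cuboids `K_L`. The points of `K_L` which are not far spacelike to the origin form a vanishing
fraction of `K_L` (for spacetime translations because `ε < 1`), so by locality these averages
asymptotically commute with all local operators. By irreducibility their weak limit points are
multiples of the identity, and the multiple is `0` because `ω₀` vanishes on the averages. Hence the
averages converge weakly to `0`, that is, `ker ω₀ ⊂ 𝔄_c`.

The rest is symmetric under transposition and only uses an invariant vector (the unit) and an
invariant functional (`ω₀`). A bounded continuous function with spectral support in `{q}` is a
multiple of `e^{iqx}`, whose means do not vanish at `q`. Therefore `A - ω₀(A) I`, which lies in
`𝔄_c`, is zero if `A` has spectral support in a point; and `φ ∘ α` has the same means and the same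
spectral support on `A` as on `A - ω₀(A) I` if `φ(I) = 0`, which carries the result over to the dual
action.
-/

section DilationMeans

variable {E : Type*} [NormedAddCommGroup E] [NormedSpace ℝ E] [MeasurableSpace E] [BorelSpace E]
  {μ : Measure E} {F h : E → ℂ} {C : ℝ}

theorem tendsto_integral_norm_comp_sub_sub [FiniteDimensional ℝ E] [μ.IsAddHaarMeasure]
    (hh : Integrable h μ) :
    Tendsto (fun y => ∫ u, ‖h (u - y) - h u‖ ∂μ) (𝓝 0) (𝓝 0) := by
  have hmp : ∀ y, MeasurePreserving (fun u => u - y) μ μ := measurePreserving_sub_right μ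
  let translate : C(E, C(E, E)) := (ContinuousMap.mk fun p : E × E => p.2 - p.1).curry
  have hcont : Tendsto (fun y => Lp.compMeasurePreserving (translate y) (hmp y) hh.toL1) (𝓝 0)
      (𝓝 (Lp.compMeasurePreserving (translate 0) (hmp 0) hh.toL1)) :=
    tendsto_const_nhds.compMeasurePreservingLp (translate.continuous.tendsto 0) hmp (hmp 0)
      ENNReal.one_ne_top
  have hcomp : ∀ y, Lp.compMeasurePreserving (translate y) (hmp y) hh.toL1 =
      ((hmp y).integrable_comp_of_integrable hh).toL1 := fun y =>
    Lp.toLp_compMeasurePreserving (memLp_one_iff_integrable.2 hh) (hmp y)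
  have hzero := (tendsto_iff_norm_sub_tendsto_zero.1 hcont)
  refine hzero.congr fun y => ?_
  rw [hcomp, hcomp, ← Integrable.toL1_sub, L1.norm_of_fun_eq_integral_norm]
  simp

theorem tendsto_integral_dilation_zero (hF : Continuous F) (hC : ∀ x, ‖F x‖ ≤ C)
    (hh : Integrable h μ) (y : E) :
    Tendsto (fun t : ℝ => ∫ u, F (t • u + y) * h u ∂μ) (𝓝 0) (𝓝 (F y * ∫ u, h u ∂μ)) := by
  rw [← integral_const_mul]
  refine tendsto_integral_filter_of_dominated_convergence (fun u => C * ‖h u‖)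
    (.of_forall fun t => ?_) (.of_forall fun t => .of_forall fun u => ?_)
    (hh.norm.const_mul C) (.of_forall fun u => ?_)
  · exact (by fun_prop : Continuous fun u => F (t • u + y)).aestronglyMeasurable.mul hh.1
  · rw [norm_mul]
    gcongr
    exact hC _
  · have hlim : Continuous fun t : ℝ => F (t • u + y) * h u := by fun_prop
    simpa using hlim.tendsto 0

/-- Translating `F` by `y` amounts to translating `h` by `t⁻¹ • y`, which is small in `L¹`. -/
theorem tendsto_integral_dilation_sub [FiniteDimensional ℝ E] [μ.IsAddHaarMeasure]
    (hF : Continuous F) (hC : ∀ x, ‖F x‖ ≤ C) (hh : Integrable h μ) (y : E) :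
    Tendsto (fun t : ℝ => ∫ u, F (t • u + y) * h u ∂μ - ∫ u, F (t • u) * h u ∂μ) atTop (𝓝 0) := by
  have hint : ∀ t : ℝ, ∀ {k : E → ℂ}, Integrable k μ → Integrable (fun u => F (t • u) * k u) μ :=
    fun t k hk => hk.bdd_mul (by fun_prop : Continuous fun u => F (t • u)).aestronglyMeasurable
      (.of_forall fun u => hC _)
  have hshift : ∀ t : ℝ, t ≠ 0 → ∫ u, F (t • u + y) * h u ∂μ - ∫ u, F (t • u) * h u ∂μ =
      ∫ u, F (t • u) * (h (u - t⁻¹ • y) - h u) ∂μ := fun t ht => by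
    simp only [mul_sub]
    rw [integral_sub (hint t (hh.comp_sub_right _)) (hint t hh),
      ← integral_sub_right_eq_self (fun u => F (t • u + y) * h u) (t⁻¹ • y)]
    simp only [smul_sub, smul_inv_smul₀ ht, sub_add_cancel]
  have hbound : ∀ t : ℝ, ‖∫ u, F (t • u) * (h (u - t⁻¹ • y) - h u) ∂μ‖ ≤
      C * ∫ u, ‖h (u - t⁻¹ • y) - h u‖ ∂μ := fun t => by
    rw [← integral_const_mul]
    refine norm_integral_le_of_norm_le (((hh.comp_sub_right _).sub hh).norm.const_mul C)
      (.of_forall fun u => ?_)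
    rw [norm_mul]
    gcongr
    exact hC _
  have hy : Tendsto (fun t : ℝ => t⁻¹ • y) atTop (𝓝 0) := by
    simpa using (tendsto_inv_atTop_zero (𝕜 := ℝ)).smul_const y
  refine (squeeze_zero_norm hbound ?_).congr' ?_
  · simpa using ((tendsto_integral_norm_comp_sub_sub hh).comp hy).const_mul C
  · filter_upwards [eventually_ne_atTop 0] with t ht
    exact (hshift t ht).symm

end DilationMeans

section FormFourier

open scoped FourierTransform SchwartzMap

variable {d : ℕ} {B : LinearMap.BilinForm ℝ (Fin d → ℝ)} {g : (Fin d → ℝ) → ℂ}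

/-- The Fourier transform `∫ dp e^{-ipx} g(p)` of a test function, where `px` is `B p x`. -/
noncomputable def formFourier (B : LinearMap.BilinForm ℝ (Fin d → ℝ)) (g : (Fin d → ℝ) → ℂ)
    (x : Fin d → ℝ) : ℂ :=
  ∫ p : Fin d → ℝ, Complex.exp (-Complex.I * (B p x : ℝ)) * g p

theorem fourierPairing_eq_zero_iff (B : LinearMap.BilinForm ℝ (Fin d → ℝ))
    (F g : (Fin d → ℝ) → ℂ) :
    fourierPairing B F g = 0 ↔ ∫ x, F x * formFourier B g x = 0 := by
  change _ * _ = (0 : ℂ) ↔ _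
  rw [mul_eq_zero, or_iff_right]
  · rfl
  · exact_mod_cast (Real.rpow_pos_of_pos (by positivity) _).ne'

theorem exists_equiv_inner_eq (hB : B.SeparatingRight) :
    ∃ S : (Fin d → ℝ) ≃L[ℝ] EuclideanSpace ℝ (Fin d),
      ∀ v x, 2 * Real.pi * inner ℝ v (S x) = B v.ofLp x := by
  let M := LinearMap.toMatrix₂' ℝ B
  have hM : ∀ p x, p ⬝ᵥ M.mulVec x = B p x := fun p x => by
    rw [← Matrix.toLinearMap₂'_apply', Matrix.toLinearMap₂'_toMatrix']
  have hinj : Function.Injective M.mulVecLin := by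
    refine (injective_iff_map_eq_zero _).2 fun x hx => hB x fun p => ?_
    rw [← hM, ← Matrix.mulVecLin_apply, hx, dotProduct_zero]
  have hpi : (2 * Real.pi)⁻¹ ≠ 0 := by positivity
  let T : (Fin d → ℝ) ≃ₗ[ℝ] (Fin d → ℝ) := .ofInjectiveEndo M.mulVecLin hinj
  refine ⟨(T.trans (.smulOfNeZero ℝ _ _ hpi)).toContinuousLinearEquiv.trans
    (EuclideanSpace.equiv (Fin d) ℝ).symm, fun v x => ?_⟩
  have hinner : inner ℝ v (WithLp.toLp 2 ((2 * Real.pi)⁻¹ • M.mulVec x)) =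
      v.ofLp ⬝ᵥ (2 * Real.pi)⁻¹ • M.mulVec x := by
    simp [PiLp.inner_apply, dotProduct, mul_comm]
  change 2 * Real.pi * inner ℝ v (WithLp.toLp 2 ((2 * Real.pi)⁻¹ • M.mulVec x)) = _
  rw [hinner, dotProduct_smul, hM, smul_eq_mul]
  field_simp

theorem formFourier_eq_fourier {S : (Fin d → ℝ) ≃L[ℝ] EuclideanSpace ℝ (Fin d)}
    (hS : ∀ v x, 2 * Real.pi * inner ℝ v (S x) = B v.ofLp x) (g : (Fin d → ℝ) → ℂ) :
    formFourier B g = 𝓕 (g ∘ EuclideanSpace.equiv (Fin d) ℝ) ∘ S := by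
  funext x
  rw [Function.comp_apply, Real.fourier_eq', formFourier,
    ← (PiLp.volume_preserving_ofLp (Fin d)).integral_comp
      (MeasurableEquiv.toLp 2 (Fin d → ℝ)).symm.measurableEmbedding]
  refine integral_congr_ae (.of_forall fun v => ?_)
  simp only [Function.comp_apply, smul_eq_mul, ← hS]
  congr 2
  push_cast
  ring

theorem exists_schwartzMap_eq_formFourier (hB : B.SeparatingRight) (hg : ContDiff ℝ ∞ g)
    (hg' : HasCompactSupport g) : ∃ h : 𝓢(Fin d → ℝ, ℂ), ⇑h = formFourier B g := by
  obtain ⟨S, hS⟩ := exists_equiv_inner_eq hB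
  let e := EuclideanSpace.equiv (Fin d) ℝ
  refine ⟨SchwartzMap.compCLMOfContinuousLinearEquiv ℂ S
    (𝓕 (SchwartzMap.compCLMOfContinuousLinearEquiv ℂ e (hg'.toSchwartzMap hg))), ?_⟩
  rw [formFourier_eq_fourier hS]
  rfl

theorem integrable_formFourier (hB : B.SeparatingRight) (hg : ContDiff ℝ ∞ g)
    (hg' : HasCompactSupport g) : Integrable (formFourier B g) := by
  obtain ⟨h, hh⟩ := exists_schwartzMap_eq_formFourier hB hg hg'
  exact hh ▸ h.integrable

theorem integrable_mul_formFourier (hB : B.SeparatingRight) (hg : ContDiff ℝ ∞ g)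
    (hg' : HasCompactSupport g) {F : (Fin d → ℝ) → ℂ} (hF : Continuous F) {C : ℝ}
    (hC : ∀ x, ‖F x‖ ≤ C) : Integrable fun x => F x * formFourier B g x :=
  (integrable_formFourier hB hg hg').bdd_mul hF.aestronglyMeasurable (.of_forall hC)

theorem exists_integral_formFourier (hB : B.SeparatingRight) :
    ∃ K : ℂ, K ≠ 0 ∧ ∀ g : (Fin d → ℝ) → ℂ, ContDiff ℝ ∞ g → HasCompactSupport g →
      ∫ x, formFourier B g x = K * g 0 := by
  obtain ⟨S, hS⟩ := exists_equiv_inner_eq hB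
  let ν : Measure (EuclideanSpace ℝ (Fin d)) := Measure.map S volume
  have : ν.IsAddHaarMeasure := S.isAddHaarMeasure_map _
  refine ⟨(ν.addHaarScalarFactor volume : ℝ), ?_, fun g hg hg' => ?_⟩
  · exact_mod_cast (Measure.addHaarScalarFactor_pos_of_isAddHaarMeasure ν volume).ne'
  let f : 𝓢(EuclideanSpace ℝ (Fin d), ℂ) := SchwartzMap.compCLMOfContinuousLinearEquiv ℂ
    (EuclideanSpace.equiv (Fin d) ℝ) (hg'.toSchwartzMap hg)
  have hinv : ∫ v, (𝓕 f) v = f 0 := by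
    have hzero := DFunLike.congr_fun
      (FourierTransform.fourierInv_fourier_eq (F := 𝓢(EuclideanSpace ℝ (Fin d), ℂ)) f) 0
    rw [SchwartzMap.fourierInv_coe, Real.fourierInv_eq'] at hzero
    simpa using hzero
  calc ∫ x, formFourier B g x = ∫ x, (𝓕 f) (S x) := by rw [formFourier_eq_fourier hS]; rfl
    _ = ∫ v, (𝓕 f) v ∂ν := (S.toHomeomorph.measurableEmbedding.integral_map _).symm
    _ = ν.addHaarScalarFactor volume • ∫ v, (𝓕 f) v := by
      rw [← integral_smul_nnreal_measure, ← Measure.isAddLeftInvariant_eq_smul]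
    _ = (ν.addHaarScalarFactor volume : ℝ) * g 0 := by
      rw [hinv, NNReal.smul_def, Complex.real_smul]
      rfl

theorem integrable_exp_mul (B : LinearMap.BilinForm ℝ (Fin d → ℝ)) (hg : Continuous g)
    (hg' : HasCompactSupport g) (x : Fin d → ℝ) :
    Integrable fun p => Complex.exp (-Complex.I * (B p x : ℝ)) * g p := by
  have hc : Continuous fun p => B p x := (B.flip x).continuous_of_finiteDimensional
  exact Continuous.integrable_of_hasCompactSupport (by fun_prop) hg'.mul_left

theorem formFourier_sub {g₁ g₂ : (Fin d → ℝ) → ℂ} (h₁ : Continuous g₁)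
    (h₁' : HasCompactSupport g₁) (h₂ : Continuous g₂) (h₂' : HasCompactSupport g₂)
    (x : Fin d → ℝ) :
    formFourier B (fun p => g₁ p - g₂ p) x = formFourier B g₁ x - formFourier B g₂ x := by
  simp only [formFourier, mul_sub]
  exact integral_sub (integrable_exp_mul B h₁ h₁' x) (integrable_exp_mul B h₂ h₂' x)

theorem formFourier_sum {ι : Type*} [Fintype ι] {g : ι → (Fin d → ℝ) → ℂ}
    (h : ∀ i, Continuous (g i)) (h' : ∀ i, HasCompactSupport (g i)) (x : Fin d → ℝ) :
    formFourier B (fun p => ∑ i, g i p) x = ∑ i, formFourier B (g i) x := by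
  simp only [formFourier, Finset.mul_sum]
  exact integral_finsetSum _ fun i _ => integrable_exp_mul B (h i) (h' i) x

theorem formFourier_exp_mul (y x : Fin d → ℝ) :
    formFourier B (fun p => Complex.exp (Complex.I * (B p y : ℝ)) * g p) x =
      formFourier B g (x - y) := by
  refine integral_congr_ae (.of_forall fun p => ?_)
  simp only [map_sub, Complex.ofReal_sub, ← mul_assoc, ← Complex.exp_add]
  congr 2
  ring

theorem formFourier_comp_sub (q x : Fin d → ℝ) :
    formFourier B (fun p => g (p - q)) x =
      Complex.exp (-Complex.I * (B q x : ℝ)) * formFourier B g x := by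
  rw [formFourier, formFourier, ← integral_const_mul, ← integral_add_right_eq_self _ q]
  refine integral_congr_ae (.of_forall fun p => ?_)
  simp only [map_add, LinearMap.add_apply, Complex.ofReal_add, ← mul_assoc, ← Complex.exp_add,
    add_sub_cancel_right]
  congr 2
  ring

theorem formFourier_comp_smul {t : ℝ} (ht : 0 < t) (x : Fin d → ℝ) :
    formFourier B (fun p => g (t • p)) x = (t⁻¹ ^ d : ℝ) • formFourier B g (t⁻¹ • x) := by
  have hscale := Measure.integral_comp_smul (volume : Measure (Fin d → ℝ))
    (fun p => Complex.exp (-Complex.I * (B p (t⁻¹ • x) : ℝ)) * g p) t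
  rw [Module.finrank_fin_fun, abs_of_pos (by positivity), ← inv_pow] at hscale
  rw [formFourier, formFourier, ← hscale]
  simp [ht.ne']

theorem integral_mul_formFourier_comp_smul {t : ℝ} (ht : 0 < t) (F : (Fin d → ℝ) → ℂ) :
    ∫ x, F x * formFourier B (fun p => g (t • p)) x = ∫ x, F (t • x) * formFourier B g x := by
  have hscale := Measure.integral_comp_smul (volume : Measure (Fin d → ℝ))
    (fun x => F x * formFourier B g (t⁻¹ • x)) t
  rw [Module.finrank_fin_fun, abs_of_pos (by positivity), ← inv_pow] at hscale
  simp only [inv_smul_smul₀ ht.ne'] at hscale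
  simp only [hscale, formFourier_comp_smul ht, mul_smul_comm, integral_smul]

theorem integral_mul_formFourier_exp_mul_comp_smul {t : ℝ} (ht : 0 < t) (F : (Fin d → ℝ) → ℂ)
    (y : Fin d → ℝ) :
    ∫ x, F x * formFourier B (fun p => Complex.exp (Complex.I * (B p y : ℝ)) * g (t • p)) x =
      ∫ x, F (t • x + y) * formFourier B g x := by
  simp only [formFourier_exp_mul (g := fun p => g (t • p))]
  rw [← integral_mul_formFourier_comp_smul ht fun x => F (x + y), ← integral_add_right_eq_self _ y]
  simp only [add_sub_cancel_right]

end FormFourier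

section PointSupport

variable {d : ℕ} {B : LinearMap.BilinForm ℝ (Fin d → ℝ)} {F : (Fin d → ℝ) → ℂ} {C : ℝ}

open scoped Manifold in
theorem exists_smooth_decomposition {g : (Fin d → ℝ) → ℂ} (hg : ContDiff ℝ ∞ g)
    (hg' : HasCompactSupport g) {V : (Fin d → ℝ) → Set (Fin d → ℝ)}
    (hV : ∀ p ∈ tsupport g, IsOpen (V p) ∧ p ∈ V p) :
    ∃ (t : Finset (Fin d → ℝ)) (f : t → (Fin d → ℝ) → ℂ), ↑t ⊆ tsupport g ∧
      (∀ i, ContDiff ℝ ∞ (f i) ∧ HasCompactSupport (f i) ∧ tsupport (f i) ⊆ V i) ∧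
      g = fun p => ∑ i, f i p := by
  have hK : IsCompact (tsupport g) := hg'
  obtain ⟨t, ht, hcov⟩ := hK.elim_nhds_subcover V fun p hp => (hV p hp).1.mem_nhds (hV p hp).2
  obtain ⟨ρ, hρ⟩ := SmoothPartitionOfUnity.exists_isSubordinate 𝓘(ℝ, Fin d → ℝ) hK.isClosed
    (fun i : t => V i) (fun i => (hV i (ht i i.2)).1) (by simpa [Set.iUnion_subtype] using hcov)
  refine ⟨t, fun i p => (ρ i p : ℂ) * g p, ht, fun i => ⟨?_, hg'.mul_left, ?_⟩, ?_⟩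
  · exact (Complex.ofRealCLM.contDiff.comp (ρ i).contMDiff.contDiff).mul hg
  · have hsupp : Function.support (fun p => (ρ i p : ℂ) * g p) ⊆ Function.support (ρ i) :=
      fun p hp => Complex.ofReal_ne_zero.1 (left_ne_zero_of_mul hp)
    exact (closure_mono hsupp).trans (hρ i)
  · funext p
    by_cases hp : p ∈ tsupport g
    · have hone := ρ.sum_eq_one hp
      rw [finsum_eq_sum_of_fintype] at hone
      rw [← Finset.sum_mul, ← Complex.ofReal_sum, hone, Complex.ofReal_one, one_mul]
    · simp [image_eq_zero_of_notMem_tsupport hp]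

theorem integral_mul_formFourier_eq_zero (hB : B.SeparatingRight) (hF : Continuous F)
    (hC : ∀ x, ‖F x‖ ≤ C) {g : (Fin d → ℝ) → ℂ} (hg : ContDiff ℝ ∞ g)
    (hg' : HasCompactSupport g) (hd : Disjoint (tsupport g) (fourierSupport B F)) :
    ∫ x, F x * formFourier B g x = 0 := by
  have hlocal : ∀ p ∈ tsupport g, ∃ V : Set (Fin d → ℝ), (IsOpen V ∧ p ∈ V) ∧
      ∀ f : (Fin d → ℝ) → ℂ, ContDiff ℝ ∞ f → HasCompactSupport f → tsupport f ⊆ V →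
        ∫ x, F x * formFourier B f x = 0 := by
    intro p hp
    have hp' := Set.disjoint_left.1 hd hp
    simp only [fourierSupport, Set.mem_ofPred_eq, ne_eq, fourierPairing_eq_zero_iff] at hp'
    push Not at hp'
    obtain ⟨V, hVo, hpV, hV⟩ := hp'
    exact ⟨V, ⟨hVo, hpV⟩, hV⟩
  choose! V hVo hV using hlocal
  obtain ⟨t, f, ht, hf, rfl⟩ := exists_smooth_decomposition hg hg' hVo
  simp only [formFourier_sum (fun i => (hf i).1.continuous) fun i => (hf i).2.1, Finset.mul_sum]
  rw [integral_finsetSum _ fun i _ =>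
    integrable_mul_formFourier hB (hf i).1 (hf i).2.1 hF hC]
  exact Finset.sum_eq_zero fun i _ => hV i (ht i.2) _ (hf i).1 (hf i).2.1 (hf i).2.2

theorem integral_mul_formFourier_congr (hB : B.SeparatingRight) (hF : Continuous F)
    (hC : ∀ x, ‖F x‖ ≤ C) (h₀ : fourierSupport B F ⊆ {0}) {g₁ g₂ : (Fin d → ℝ) → ℂ}
    (h₁ : ContDiff ℝ ∞ g₁) (h₁' : HasCompactSupport g₁) (h₂ : ContDiff ℝ ∞ g₂)
    (h₂' : HasCompactSupport g₂) (h : g₁ =ᶠ[𝓝 0] g₂) :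
    ∫ x, F x * formFourier B g₁ x = ∫ x, F x * formFourier B g₂ x := by
  have hdisj : Disjoint (tsupport fun p => g₁ p - g₂ p) (fourierSupport B F) := by
    refine (Set.disjoint_singleton_right.2 ?_).mono_right h₀
    rw [notMem_tsupport_iff_eventuallyEq]
    filter_upwards [h] with p hp using sub_eq_zero.2 hp
  have hzero := integral_mul_formFourier_eq_zero hB hF hC (h₁.sub h₂) (h₁'.sub h₂') hdisj
  simp only [formFourier_sub h₁.continuous h₁' h₂.continuous h₂', mul_sub] at hzero
  rwa [integral_sub (integrable_mul_formFourier hB h₁ h₁' hF hC)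
    (integrable_mul_formFourier hB h₂ h₂' hF hC), sub_eq_zero] at hzero

/-- All dilates of a test function that is constant near the origin agree there. -/
theorem integral_dilation_mul_formFourier_eq (hB : B.SeparatingRight) (hF : Continuous F)
    (hC : ∀ x, ‖F x‖ ≤ C) (h₀ : fourierSupport B F ⊆ {0}) {ψ : (Fin d → ℝ) → ℂ}
    (hψ : ContDiff ℝ ∞ ψ) (hψ' : HasCompactSupport ψ) (hψ₁ : ψ =ᶠ[𝓝 0] 1) {t t' : ℝ} (ht : 0 < t)
    (ht' : 0 < t') (y : Fin d → ℝ) :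
    ∫ u, F (t • u + y) * formFourier B ψ u = ∫ u, F (t' • u + y) * formFourier B ψ u := by
  have hexp : ContDiff ℝ ∞ fun p => Complex.exp (Complex.I * (B p y : ℝ)) := by
    have hlin : ContDiff ℝ ∞ fun p => B p y :=
      (LinearMap.toContinuousLinearMap (B.flip y)).contDiff
    exact (contDiff_const.mul (Complex.ofRealCLM.contDiff.comp hlin)).cexp
  have hsmooth (t : ℝ) : ContDiff ℝ ∞ fun p => Complex.exp (Complex.I * (B p y : ℝ)) * ψ (t • p) :=
    hexp.mul (hψ.comp (contDiff_const_smul t))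
  have hone (t : ℝ) : ∀ᶠ p in 𝓝 (0 : Fin d → ℝ), ψ (t • p) = 1 := by
    have hlim : Tendsto (fun p : Fin d → ℝ => t • p) (𝓝 0) (𝓝 0) := by
      simpa using (continuous_const_smul t).tendsto (0 : Fin d → ℝ)
    exact hlim.eventually hψ₁
  rw [← integral_mul_formFourier_exp_mul_comp_smul ht,
    ← integral_mul_formFourier_exp_mul_comp_smul ht']
  refine integral_mul_formFourier_congr hB hF hC h₀ (hsmooth t) (hψ'.comp_smul ht.ne').mul_left
    (hsmooth t') (hψ'.comp_smul ht'.ne').mul_left ?_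
  filter_upwards [hone t, hone t'] with p hp hp'
  rw [hp, hp']

/-- With `h` the transform of a bump function, `∫ F (t • u + y) h(u) du` does not depend on `t`.
It tends to `F y * ∫ h` as `t → 0`, and loses its dependence on `y` as `t → ∞`. -/
theorem eq_apply_zero_of_fourierSupport_subset_zero (hB : B.SeparatingRight) (hF : Continuous F)
    (hC : ∀ x, ‖F x‖ ≤ C) (h₀ : fourierSupport B F ⊆ {0}) (x : Fin d → ℝ) : F x = F 0 := by
  let b : ContDiffBump (0 : Fin d → ℝ) := ⟨1, 2, one_pos, one_lt_two⟩
  let ψ : (Fin d → ℝ) → ℂ := fun p => (b p : ℂ)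
  have hψ : ContDiff ℝ ∞ ψ := Complex.ofRealCLM.contDiff.comp b.contDiff
  have hψ' : HasCompactSupport ψ := b.hasCompactSupport.comp_left Complex.ofReal_zero
  have hψ₁ : ψ =ᶠ[𝓝 0] 1 := by
    filter_upwards [b.eventuallyEq_one] with p hp
    simp [ψ, hp]
  have hint : Integrable (formFourier B ψ) := integrable_formFourier hB hψ hψ'
  obtain ⟨K, hK, hKg⟩ := exists_integral_formFourier hB
  have hval : ∀ t : ℝ, 0 < t → ∀ y, ∫ u, F (t • u + y) * formFourier B ψ u = F y * K := by
    intro t ht y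
    have hlim := (tendsto_integral_dilation_zero hF hC hint y).mono_left
      (nhdsWithin_le_nhds (s := Set.Ioi 0))
    rw [hKg ψ hψ hψ', hψ₁.self_of_nhds, Pi.one_apply, mul_one] at hlim
    refine tendsto_nhds_unique (tendsto_const_nhds.congr' ?_) hlim
    filter_upwards [self_mem_nhdsWithin] with t' ht'
    exact integral_dilation_mul_formFourier_eq hB hF hC h₀ hψ hψ' hψ₁ ht ht' y
  have hconst : F x * K - F 0 * K = 0 := by
    refine tendsto_nhds_unique (tendsto_const_nhds.congr' ?_)
      (tendsto_integral_dilation_sub hF hC hint x)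
    filter_upwards [eventually_gt_atTop 0] with t ht
    rw [← hval t ht x, ← hval t ht 0]
    simp only [add_zero]
  exact mul_right_cancel₀ hK (sub_eq_zero.1 hconst)

theorem fourierSupport_exp_mul_subset (q : Fin d → ℝ) :
    fourierSupport B (fun x => Complex.exp (-Complex.I * (B q x : ℝ)) * F x) ⊆
      (fun p => p + q) ⁻¹' fourierSupport B F := by
  intro p hp V hV hpV
  obtain ⟨g, hg, hg', hgV, hne⟩ := hp ((fun p => p + q) ⁻¹' V)
    (hV.preimage (continuous_add_const q)) hpV
  refine ⟨fun p => g (p - q), hg.comp (contDiff_id.sub contDiff_const),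
    hg'.comp_homeomorph (Homeomorph.subRight q), ?_, ?_⟩
  · change tsupport (g ∘ Homeomorph.subRight q) ⊆ V
    rw [tsupport_comp_eq_preimage]
    intro p hp
    simpa using hgV hp
  · rw [Ne, fourierPairing_eq_zero_iff] at hne ⊢
    simpa only [formFourier_comp_sub, mul_left_comm, mul_assoc] using hne

theorem eq_exp_mul_of_fourierSupport_subset (hB : B.SeparatingRight) (hF : Continuous F)
    (hC : ∀ x, ‖F x‖ ≤ C) {q : Fin d → ℝ} (hq : fourierSupport B F ⊆ {q}) (x : Fin d → ℝ) :
    F x = Complex.exp (Complex.I * (B q x : ℝ)) * F 0 := by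
  have hBc : Continuous fun x => B q x := (B q).continuous_of_finiteDimensional
  have hnorm : ∀ x, ‖Complex.exp (-Complex.I * (B q x : ℝ)) * F x‖ ≤ C := fun x => by
    simpa [Complex.norm_exp] using hC x
  have hsupp : fourierSupport B (fun x => Complex.exp (-Complex.I * (B q x : ℝ)) * F x) ⊆ {0} :=
    (fourierSupport_exp_mul_subset q).trans fun p hp => by simpa using hq hp
  have hconst := eq_apply_zero_of_fourierSupport_subset_zero hB (by fun_prop) hnorm hsupp x
  simp only [map_zero, Complex.ofReal_zero, mul_zero, Complex.exp_zero, one_mul] at hconst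
  rw [← hconst, ← mul_assoc, ← Complex.exp_add]
  simp

theorem fourierSupport_const_subset (hB : B.SeparatingRight) (c : ℂ) :
    fourierSupport B (fun _ => c) ⊆ {0} := by
  intro p hp
  by_contra hne
  obtain ⟨K, -, hK⟩ := exists_integral_formFourier hB
  obtain ⟨g, hg, hg', hgs, hg₀⟩ := hp {0}ᶜ isOpen_compl_singleton hne
  refine hg₀ ((fourierPairing_eq_zero_iff _ _ _).2 ?_)
  rw [integral_const_mul, hK g hg hg', image_eq_zero_of_notMem_tsupport (fun h0 => hgs h0 rfl),
    mul_zero, mul_zero]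

theorem zero_mem_fourierSupport_const (hB : B.SeparatingRight) {c : ℂ} (hc : c ≠ 0) :
    0 ∈ fourierSupport B (fun _ => c) := by
  intro V hV h0
  obtain ⟨K, hK, hKg⟩ := exists_integral_formFourier hB
  obtain ⟨f, hfs, hfc, hf, -, hf₀⟩ := exists_contDiff_tsupport_subset (n := ⊤) (hV.mem_nhds h0)
  have hg : ContDiff ℝ ∞ fun p => (f p : ℂ) := Complex.ofRealCLM.contDiff.comp hf
  have hg' : HasCompactSupport fun p => (f p : ℂ) := hfc.comp_left Complex.ofReal_zero
  refine ⟨fun p => (f p : ℂ), hg, hg', (closure_mono ?_).trans hfs, ?_⟩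
  · exact Function.support_comp_subset Complex.ofReal_zero f
  · rw [Ne, fourierPairing_eq_zero_iff, integral_const_mul, hKg _ hg hg', hf₀]
    simp [hc, hK]

end PointSupport

namespace IsometryGroup

variable {d : ℕ} {E F : Type*} [NormedAddCommGroup E] [NormedSpace ℂ E]
  [NormedAddCommGroup F] [NormedSpace ℂ F] {α : IsometryGroup d E F} {α' : IsometryGroup d F E}
  {B : LinearMap.BilinForm ℝ (Fin d → ℝ)} {l : ℝ → Fin d → ℝ} {q : Fin d → ℝ} {A e : E} {φ η : F}
  {c : ℂ}

theorem mean_eq_integral_cond (α : IsometryGroup d E F) (B : LinearMap.BilinForm ℝ (Fin d → ℝ))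
    (l q : Fin d → ℝ) (φ : F) (A : E) :
    α.mean B l q φ A = ∫ x, Complex.exp (-Complex.I * (B q x : ℝ)) * α.pairing φ (α.act x A)
      ∂ProbabilityTheory.cond volume (Set.Icc (-l) l) := by
  rw [ProbabilityTheory.cond, integral_smul_measure, ENNReal.toReal_inv, Complex.real_smul]
  rfl

theorem isProbabilityMeasure_cond_Icc {l : Fin d → ℝ} (hl : ∀ i, 0 < l i) :
    IsProbabilityMeasure (ProbabilityTheory.cond volume (Set.Icc (-l) l)) := by
  refine ProbabilityTheory.cond_isProbabilityMeasure_of_finite ?_ isCompact_Icc.measure_ne_top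
  rw [Real.volume_Icc_pi]
  exact Finset.prod_ne_zero_iff.2 fun i _ => by simpa using hl i

theorem eq_zero_of_mem_continuousSubspace (hl : ∀ᶠ L in atTop, ∀ i, 0 < l L i)
    (hA : A ∈ α.continuousSubspace B l)
    (h : ∀ x, α.pairing φ (α.act x A) = Complex.exp (Complex.I * (B q x : ℝ)) * c) : c = 0 := by
  have hc : ∀ x, Complex.exp (-Complex.I * (B q x : ℝ)) * α.pairing φ (α.act x A) = c := fun x => by
    rw [h, ← mul_assoc, ← Complex.exp_add, neg_mul, neg_add_cancel, Complex.exp_zero, one_mul]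
  refine tendsto_nhds_unique (tendsto_const_nhds.congr' ?_) (hA q φ)
  filter_upwards [hl] with L hL
  have := isProbabilityMeasure_cond_Icc hL
  simp only [mean_eq_integral_cond, hc, integral_const, probReal_univ, one_smul]

theorem pairing_act_of_mem_spectralSubspace (hB : B.SeparatingRight)
    (hA : A ∈ α.spectralSubspace B {q}) (φ : F) (x : Fin d → ℝ) :
    α.pairing φ (α.act x A) = Complex.exp (Complex.I * (B q x : ℝ)) * α.pairing φ A := by
  have h := eq_exp_mul_of_fourierSupport_subset hB (α.continuous_pairing φ A)
    (C := ‖φ‖ * ‖A‖) (fun x => by simpa using α.norm_pairing_le φ (α.act x A)) (hA φ) x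
  rwa [α.act_zero] at h

/-- `α'` is the transpose of `α` with respect to the pairing of the two spaces. -/
def IsTranspose (α : IsometryGroup d E F) (α' : IsometryGroup d F E) : Prop :=
  ∀ x A φ, α'.pairing A (α'.act x φ) = α.pairing φ (α.act x A)

namespace IsTranspose

theorem symm (h : IsTranspose α α') : IsTranspose α' α := fun x φ A => (h x A φ).symm

theorem pairing_eq (h : IsTranspose α α') (A : E) (φ : F) : α'.pairing A φ = α.pairing φ A := by
  simpa only [act_zero] using h 0 A φ

theorem mean_eq (h : IsTranspose α α') (l : Fin d → ℝ) : α'.mean B l q A φ = α.mean B l q φ A := by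
  simp only [mean, h _ A φ]

end IsTranspose

/-- A vector `e` and a functional `η` which are invariant under `α` and normalized to `η(e) = 1`;
in quantum field theory, the unit and the vacuum state. Invariance is required only weakly, that is
under the pairing, so that the notion is symmetric under transposition. -/
structure InvariantPair (α : IsometryGroup d E F) (e : E) (η : F) : Prop where
  pairing_act_vector : ∀ φ x, α.pairing φ (α.act x e) = α.pairing φ e
  pairing_act_functional : ∀ A x, α.pairing η (α.act x A) = α.pairing η A
  pairing_eq_one : α.pairing η e = 1

namespace InvariantPair

theorem transpose (h : InvariantPair α e η) (ht : IsTranspose α α') : InvariantPair α' η e where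
  pairing_act_vector A x := by rw [ht, ht.pairing_eq, h.pairing_act_functional]
  pairing_act_functional φ x := by rw [ht, ht.pairing_eq, h.pairing_act_vector]
  pairing_eq_one := by rw [ht.pairing_eq, h.pairing_eq_one]

theorem sub_smul_mem_ker (h : InvariantPair α e η) (A : E) :
    A - α.pairing η A • e ∈ LinearMap.ker (α.pairing η) := by
  simp [h.pairing_eq_one]

theorem pairing_act_sub_smul (h : InvariantPair α e η) (x : Fin d → ℝ) (φ : F) (A : E) (c : ℂ) :
    α.pairing φ (α.act x (A - c • e)) = α.pairing φ (α.act x A) - c * α.pairing φ e := by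
  simp [h.pairing_act_vector]

theorem isCompl_span_ker (h : InvariantPair α e η) :
    IsCompl (Submodule.span ℂ {e}) (LinearMap.ker (α.pairing η)) := by
  have he : α.pairing η e ≠ 0 := by simp [h.pairing_eq_one]
  have hsurj : Function.Surjective (α.pairing η) :=
    LinearMap.surjective fun h0 => he (by rw [h0, LinearMap.zero_apply])
  exact (Submodule.isCompl_span_singleton_of_isCoatom_of_notMem
    (LinearMap.isCoatom_ker_of_surjective hsurj) he).symm

theorem continuousSubspace_eq_ker (h : InvariantPair α e η) (hl : ∀ᶠ L in atTop, ∀ i, 0 < l L i)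
    (hker : LinearMap.ker (α.pairing η) ≤ α.continuousSubspace B l) :
    α.continuousSubspace B l = LinearMap.ker (α.pairing η) := by
  refine le_antisymm (fun A hA => ?_) hker
  exact eq_zero_of_mem_continuousSubspace hl hA (q := 0) (φ := η) fun x => by
    simp [h.pairing_act_functional]

theorem spectralSubspace_singleton_subset (h : InvariantPair α e η) (hB : B.SeparatingRight)
    (hsep : α.pairing.SeparatingRight) (hl : ∀ᶠ L in atTop, ∀ i, 0 < l L i)
    (hker : LinearMap.ker (α.pairing η) ≤ α.continuousSubspace B l) (q : Fin d → ℝ) :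
    α.spectralSubspace B {q} ⊆ Submodule.span ℂ {e} := by
  intro A hA
  have hη : ∀ x, α.pairing η A = Complex.exp (Complex.I * (B q x : ℝ)) * α.pairing η A := fun x =>
    (h.pairing_act_functional A x).symm.trans (pairing_act_of_mem_spectralSubspace hB hA η x)
  have hzero : A - α.pairing η A • e = 0 := hsep _ fun φ =>
    eq_zero_of_mem_continuousSubspace hl (hker (h.sub_smul_mem_ker A)) (q := q) (φ := φ)
      fun x => by
        rw [h.pairing_act_sub_smul, pairing_act_of_mem_spectralSubspace hB hA, map_sub, map_smul,
          smul_eq_mul, mul_sub, ← mul_assoc (Complex.exp _) (α.pairing η A), ← hη]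
  rw [sub_eq_zero.1 hzero]
  exact Submodule.smul_mem _ _ (Submodule.mem_span_singleton_self e)

theorem purePointSubspace_eq_span (h : InvariantPair α e η) (hB : B.SeparatingRight)
    (hsep : α.pairing.SeparatingRight) (hl : ∀ᶠ L in atTop, ∀ i, 0 < l L i)
    (hker : LinearMap.ker (α.pairing η) ≤ α.continuousSubspace B l) :
    α.purePointSubspace B = Submodule.span ℂ {e} := by
  refine le_antisymm (Submodule.topologicalClosure_minimal _ (Submodule.span_le.2 ?_)
    (Submodule.closed_of_finiteDimensional _)) ?_
  · exact Set.iUnion₂_subset fun q _ => h.spectralSubspace_singleton_subset hB hsep hl hker q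
  · have hspectrum : 0 ∈ α.spectrum B := by
      refine subset_closure (Set.mem_iUnion₂.2 ⟨e, trivial, Set.mem_iUnion.2 ⟨η, ?_⟩⟩)
      simpa only [h.pairing_act_vector, h.pairing_eq_one] using
        zero_mem_fourierSupport_const hB one_ne_zero
    have hspectral : e ∈ α.spectralSubspace B {0} := fun φ => by
      simpa only [h.pairing_act_vector] using fourierSupport_const_subset hB _
    rw [Submodule.span_singleton_le_iff_mem]
    exact Submodule.le_topologicalClosure _
      (Submodule.subset_span (Set.mem_iUnion₂.2 ⟨0, hspectrum, hspectral⟩))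

theorem ker_le_continuousSubspace_transpose (h : InvariantPair α e η) (ht : IsTranspose α α')
    (hker : LinearMap.ker (α.pairing η) ≤ α.continuousSubspace B l) :
    LinearMap.ker (α'.pairing e) ≤ α'.continuousSubspace B l := by
  intro φ hφ q A
  have hφe : α.pairing φ e = 0 := by rwa [← ht.pairing_eq]
  refine (hker (h.sub_smul_mem_ker A) q φ).congr fun L => ?_
  rw [ht.mean_eq]
  simp only [mean, h.pairing_act_sub_smul, hφe, mul_zero, sub_zero]

theorem spectrumOn_ker_le_transpose (h : InvariantPair α e η) (ht : IsTranspose α α') :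
    α.spectrumOn B (LinearMap.ker (α.pairing η)) ⊆
      α'.spectrumOn B (LinearMap.ker (α'.pairing e)) := by
  refine closure_mono (Set.iUnion₂_subset fun A hA => Set.iUnion_subset fun φ => ?_)
  refine Set.Subset.trans (subset_of_eq ?_) (Set.subset_iUnion₂_of_subset _
    ((h.transpose ht).sub_smul_mem_ker φ) (Set.subset_iUnion_of_subset A subset_rfl))
  simp only [(h.transpose ht).pairing_act_sub_smul, ht _ A φ, ht.pairing_eq A η,
    LinearMap.mem_ker.1 hA, mul_zero, sub_zero]

theorem spectral_decomposition (h : InvariantPair α e η) (ht : IsTranspose α α')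
    (hB : B.SeparatingRight) (hsep : α.pairing.Nondegenerate)
    (hl : ∀ᶠ L in atTop, ∀ i, 0 < l L i)
    (hker : LinearMap.ker (α.pairing η) ≤ α.continuousSubspace B l) :
    (IsCompl (α.purePointSubspace B) (α.continuousSubspace B l) ∧
        α.purePointSubspace B = Submodule.span ℂ {e} ∧
        α.continuousSubspace B l = LinearMap.ker (α.pairing η)) ∧
      (IsCompl (α'.purePointSubspace B) (α'.continuousSubspace B l) ∧
        α'.purePointSubspace B = Submodule.span ℂ {η} ∧
        α'.continuousSubspace B l = LinearMap.ker (α'.pairing e)) ∧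
      α.continuousSpectrum B l = α'.continuousSpectrum B l := by
  have h' := h.transpose ht
  have hker' := h.ker_le_continuousSubspace_transpose ht hker
  have hsep' : α'.pairing.SeparatingRight := fun φ hφ =>
    hsep.1 φ fun A => (ht.pairing_eq A φ).symm.trans (hφ A)
  rw [continuousSpectrum, continuousSpectrum, h.purePointSubspace_eq_span hB hsep.2 hl hker,
    h'.purePointSubspace_eq_span hB hsep' hl hker', h.continuousSubspace_eq_ker hl hker,
    h'.continuousSubspace_eq_ker hl hker']
  exact ⟨⟨h.isCompl_span_ker, rfl, rfl⟩, ⟨h'.isCompl_span_ker, rfl, rfl⟩,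
    (h.spectrumOn_ker_le_transpose ht).antisymm (h'.spectrumOn_ker_le_transpose ht.symm)⟩

end InvariantPair

end IsometryGroup

section Schur

theorem exists_cfc_mul_cfc_eq_zero {A : Type*} [CStarAlgebra A] {T : A} (hT : IsSelfAdjoint T)
    {a b : ℝ} (ha : a ∈ spectrum ℝ T) (hb : b ∈ spectrum ℝ T) (hab : a < b) :
    ∃ f g : ℝ → ℝ, cfc f T ≠ 0 ∧ cfc g T ≠ 0 ∧ cfc f T * cfc g T = 0 := by
  have hne : ∀ f : ℝ → ℝ, Continuous f → ∀ t ∈ spectrum ℝ T, f t ≠ 0 → cfc f T ≠ 0 := by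
    intro f hf t ht hft h
    have : Nontrivial A := by
      by_contra hA
      rw [not_nontrivial_iff_subsingleton] at hA
      simp at ht
    have hmem : f t ∈ spectrum ℝ (cfc f T) := by
      rw [cfc_map_spectrum f T hT hf.continuousOn]
      exact Set.mem_image_of_mem f ht
    rw [h, spectrum.zero_eq] at hmem
    exact hft hmem
  let f : ℝ → ℝ := fun t => max ((a + b) / 2 - t) 0
  let g : ℝ → ℝ := fun t => max (t - (a + b) / 2) 0
  have hf : Continuous f := by fun_prop
  have hg : Continuous g := by fun_prop
  have hfg : ∀ t, f t * g t = 0 := fun t => by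
    rcases le_total t ((a + b) / 2) with h | h <;> simp [f, g, h]
  refine ⟨f, g, hne f hf a ha (lt_max_of_lt_left (by linarith)).ne',
    hne g hg b hb (lt_max_of_lt_left (by linarith)).ne', ?_⟩
  rw [← cfc_mul f g T hf.continuousOn hg.continuousOn, funext hfg, cfc_const_zero]

variable {H : Type*} [NormedAddCommGroup H] [InnerProductSpace ℂ H] [CompleteSpace H]
  {M : StarSubalgebra ℂ (H →L[ℂ] H)} {T : H →L[ℂ] H}

namespace ActsIrreducibly

theorem of_topologicalClosure (hM : ActsIrreducibly M.topologicalClosure) : ActsIrreducibly M := by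
  refine fun W hW hinv => hM W hW fun A hA v hv => ?_
  exact hW.closure_subset
    (map_mem_closure (f := fun B : H →L[ℂ] H => B v) (by fun_prop) hA fun C hC => hinv C hC v hv)

theorem eq_zero_or_eq_zero (hM : ActsIrreducibly M) {S : H →L[ℂ] H}
    (hS : ∀ A ∈ M, Commute A S) (hST : S * T = 0) : S = 0 ∨ T = 0 := by
  have hinv : ∀ A ∈ M, ∀ v ∈ S.ker, A v ∈ S.ker := fun A hA v hv => by
    have hAS : A (S v) = S (A v) := congr($(hS A hA) v)
    rw [LinearMap.mem_ker, ContinuousLinearMap.coe_coe] at hv ⊢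
    rw [← hAS, hv, map_zero]
  refine (hM S.ker S.isClosed_ker hinv).symm.imp (fun h => ?_) fun h => ?_
  · exact ContinuousLinearMap.coe_injective (LinearMap.ker_eq_top.1 h)
  · have hT : ∀ v, T v ∈ S.ker := fun v => congr($hST v)
    exact ContinuousLinearMap.ext fun v => by simpa [h] using hT v

theorem exists_eq_smul_of_isSelfAdjoint [Nontrivial H] (hM : ActsIrreducibly M)
    (hT : ∀ A ∈ M, Commute A T) (hsa : IsSelfAdjoint T) : ∃ c : ℂ, T = c • 1 := by
  obtain ⟨a, ha⟩ : (spectrum ℝ T).Nonempty := ContinuousFunctionalCalculus.spectrum_nonempty T hsa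
  have hlt : ∀ b ∈ spectrum ℝ T, ∀ c ∈ spectrum ℝ T, ¬b < c := by
    intro b hb c hc hbc
    obtain ⟨f, g, hf, hg, hfg⟩ := exists_cfc_mul_cfc_eq_zero hsa hb hc hbc
    have hcomm : ∀ A ∈ M, Commute A (cfc f T) := fun A hA => ((hT A hA).symm.cfc_real f).symm
    exact (hM.eq_zero_or_eq_zero hcomm hfg).elim hf hg
  have hspec : spectrum ℝ T ⊆ {a} := fun b hb =>
    le_antisymm (not_lt.1 (hlt a ha b hb)) (not_lt.1 (hlt b hb a ha))
  refine ⟨(a : ℂ), ?_⟩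
  rw [CFC.eq_algebraMap_of_spectrum_subset_singleton T a hspec, Algebra.algebraMap_eq_smul_one,
    Complex.coe_smul]

theorem exists_eq_smul_of_commute [Nontrivial H] (hM : ActsIrreducibly M)
    (hT : ∀ A ∈ M, Commute A T) : ∃ c : ℂ, T = c • 1 := by
  have hT' : ∀ A ∈ M, Commute A (star T) := fun A hA => by
    simpa using (hT (star A) (star_mem hA)).star_star
  obtain ⟨a, ha⟩ := hM.exists_eq_smul_of_isSelfAdjoint (T := realPart T)
    (fun A hA => by
      rw [realPart_apply_coe]
      exact ((hT A hA).add_right (hT' A hA)).smul_right _) (realPart T).2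
  obtain ⟨b, hb⟩ := hM.exists_eq_smul_of_isSelfAdjoint (T := imaginaryPart T)
    (fun A hA => by
      rw [imaginaryPart_apply_coe]
      exact (((hT A hA).sub_right (hT' A hA)).smul_right _).smul_right _) (imaginaryPart T).2
  refine ⟨a + Complex.I * b, ?_⟩
  rw [← realPart_add_I_smul_imaginaryPart T, ha, hb, smul_smul, add_smul]

end ActsIrreducibly

end Schur

section WeakConvergence

variable {𝕜 : Type*} [RCLike 𝕜] {ι E : Type*} [NormedAddCommGroup E] [InnerProductSpace 𝕜 E]

theorem norm_inner_apply_le (T : E →L[𝕜] E) (ψ χ : E) :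
    ‖inner 𝕜 ψ (T χ)‖ ≤ ‖T‖ * ‖ψ‖ * ‖χ‖ :=
  calc ‖inner 𝕜 ψ (T χ)‖ ≤ ‖ψ‖ * ‖T χ‖ := norm_inner_le_norm ψ (T χ)
    _ ≤ ‖ψ‖ * (‖T‖ * ‖χ‖) := by gcongr; exact T.le_opNorm χ
    _ = ‖T‖ * ‖ψ‖ * ‖χ‖ := by ring

theorem exists_forall_tendsto_inner [CompleteSpace E] (𝒰 : Ultrafilter ι) {T : ι → E →L[𝕜] E}
    {C : ℝ} (hT : ∀ i, ‖T i‖ ≤ C) :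
    ∃ S : E →L[𝕜] E, ∀ ψ χ,
      Tendsto (fun i => inner 𝕜 ψ (T i χ)) 𝒰 (𝓝 (inner 𝕜 ψ (S χ))) := by
  have hbound : ∀ i ψ χ, ‖inner 𝕜 ψ (T i χ)‖ ≤ C * ‖ψ‖ * ‖χ‖ := fun i ψ χ =>
    (norm_inner_apply_le (T i) ψ χ).trans (by gcongr; exact hT i)
  have hlim : ∀ ψ χ, ∃ z, Tendsto (fun i => inner 𝕜 ψ (T i χ)) 𝒰 (𝓝 z) := fun ψ χ => by
    obtain ⟨z, -, hz⟩ := (isCompact_closedBall (0 : 𝕜) (C * ‖ψ‖ * ‖χ‖)).ultrafilter_le_nhds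
      (𝒰.map fun i => inner 𝕜 ψ (T i χ))
      (tendsto_principal.2 (.of_forall fun i => by simpa using hbound i ψ χ))
    exact ⟨z, hz⟩
  choose b hb using hlim
  let β : E →L⋆[𝕜] E →L[𝕜] 𝕜 := (LinearMap.mk₂'ₛₗ (starRingEnd 𝕜) (RingHom.id 𝕜) b
    (fun ψ ψ' χ => tendsto_nhds_unique (hb _ _)
      (by simpa only [inner_add_left] using (hb ψ χ).add (hb ψ' χ)))
    (fun c ψ χ => tendsto_nhds_unique (hb _ _)
      (by simpa only [inner_smul_left, smul_eq_mul] using (hb ψ χ).const_mul (starRingEnd 𝕜 c)))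
    (fun ψ χ χ' => tendsto_nhds_unique (hb _ _)
      (by simpa only [map_add, inner_add_right] using (hb ψ χ).add (hb ψ χ')))
    (fun c ψ χ => tendsto_nhds_unique (hb _ _)
      (by simpa only [map_smul, inner_smul_right, smul_eq_mul, RingHom.id_apply]
        using (hb ψ χ).const_mul c))).mkContinuous₂
    C fun ψ χ => le_of_tendsto (hb ψ χ).norm (.of_forall fun i => hbound i ψ χ)
  refine ⟨star (InnerProductSpace.continuousLinearMapOfBilin β), fun ψ χ => ?_⟩
  rw [ContinuousLinearMap.star_eq_adjoint, ContinuousLinearMap.adjoint_inner_right,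
    InnerProductSpace.continuousLinearMapOfBilin_apply]
  exact hb ψ χ

variable {H : Type*} [NormedAddCommGroup H] [InnerProductSpace ℂ H] [CompleteSpace H]
  {M : StarSubalgebra ℂ (H →L[ℂ] H)} {l : Filter ι}

-- By compactness it suffices to consider ultrafilters; along these the net has a weak limit, which
-- commutes with `M` and hence is a multiple of the identity.
theorem ActsIrreducibly.tendsto_inner_zero (hM : ActsIrreducibly M) {T : ι → H →L[ℂ] H} {C : ℝ}
    (hT : ∀ i, ‖T i‖ ≤ C)
    (hcomm : ∀ A ∈ M, Tendsto (fun i => T i * A - A * T i) l (𝓝 0)) {Ω : H} (hΩ : Ω ≠ 0)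
    (hTΩ : Tendsto (fun i => inner ℂ Ω (T i Ω)) l (𝓝 0)) (ψ χ : H) :
    Tendsto (fun i => inner ℂ ψ (T i χ)) l (𝓝 0) := by
  rw [tendsto_iff_ultrafilter]
  intro 𝒰 h𝒰
  obtain ⟨S, hS⟩ := exists_forall_tendsto_inner 𝒰 hT
  have hSM : ∀ A ∈ M, Commute A S := fun A hA => by
    refine ContinuousLinearMap.ext fun χ => ext_inner_left ℂ fun ψ => ?_
    have hdiff : Tendsto (fun i => inner ℂ ψ ((T i * A - A * T i) χ)) 𝒰 (𝓝 0) := by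
      have := ((ContinuousLinearMap.apply ℂ H χ).continuous.tendsto 0).comp
        ((hcomm A hA).mono_left h𝒰)
      simpa [inner_sub_right] using (tendsto_const_nhds (x := ψ)).inner (𝕜 := ℂ) this
    have hlim : Tendsto (fun i => inner ℂ ψ ((T i * A - A * T i) χ)) 𝒰
        (𝓝 (inner ℂ ψ (S (A χ)) - inner ℂ (star A ψ) (S χ))) := by
      simpa [inner_sub_right, ContinuousLinearMap.star_eq_adjoint,
        ContinuousLinearMap.adjoint_inner_left] using (hS ψ (A χ)).sub (hS (star A ψ) χ)
    rw [mul_apply_eq_comp, mul_apply_eq_comp,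
      sub_eq_zero.1 (tendsto_nhds_unique hlim hdiff), ContinuousLinearMap.star_eq_adjoint,
      ContinuousLinearMap.adjoint_inner_left]
  have : Nontrivial H := nontrivial_of_ne Ω 0 hΩ
  obtain ⟨c, rfl⟩ := hM.exists_eq_smul_of_commute hSM
  have hc : c = 0 := by
    simpa [inner_smul_right, hΩ] using tendsto_nhds_unique (hS Ω Ω) (hTΩ.mono_left h𝒰)
  simpa [hc] using hS ψ χ

theorem tendsto_apply_of_mem_normalFunctionals {φ : StrongDual ℂ M}
    (hφ : φ ∈ normalFunctionals M) {T : ι → M} {S : M} {C : ℝ} (hT : ∀ i, ‖T i‖ ≤ C)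
    (hTS : ∀ ψ χ : H, Tendsto (fun i => inner ℂ ψ ((T i : H →L[ℂ] H) χ)) l
      (𝓝 (inner ℂ ψ ((S : H →L[ℂ] H) χ)))) :
    Tendsto (fun i => φ (T i)) l (𝓝 (φ S)) := by
  obtain ⟨ψ, χ, hsum, hφ⟩ := hφ
  simp only [← (hφ _).tsum_eq]
  refine tendsto_tsum_of_dominated_convergence (hsum.mul_left C)
    (fun n => hTS (ψ n) (χ n)) (.of_forall fun i n => ?_)
  rw [← mul_assoc]
  exact (norm_inner_apply_le (T i : H →L[ℂ] H) _ _).trans (by gcongr; exact hT i)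

end WeakConvergence

theorem norm_mul_sub_mul_le {R : Type*} [SeminormedRing R] (a b : R) :
    ‖a * b - b * a‖ ≤ 2 * ‖b‖ * ‖a‖ := by
  linarith [norm_sub_le (a * b) (b * a), norm_mul_le a b, norm_mul_le b a]

namespace QuantumFieldTheory

variable {s : ℕ} {H : Type*} [NormedAddCommGroup H] [InnerProductSpace ℂ H] [CompleteSpace H]
  (Q : QuantumFieldTheory s H) {A : Q.algebra} {C : H →L[ℂ] H} {Ω : H}

section Locality

/-- The points which are not spacelike to the origin with a margin of `R` in some coordinate
direction. Outside of this set, translations make bounded regions spacelike separated. -/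
def nearRegion (s : ℕ) (R : ℝ) : Set (Fin (s + 1) → ℝ) :=
  {x | ∀ k : Fin s, |x k.succ| ≤ |x 0| + R}

theorem spacelikeSeparated_of_abs_lt {O₁ O₂ : Set (Fin (s + 1) → ℝ)}
    (h : ∀ x ∈ O₁, ∀ y ∈ O₂, ∃ k : Fin s, |(x - y) 0| < |(x - y) k.succ|) :
    SpacelikeSeparated O₁ O₂ := by
  intro x hx y hy
  obtain ⟨k, hk⟩ := h x hx y hy
  have hsum : (x - y) k.succ * (x - y) k.succ ≤ ∑ i : Fin s, (x - y) i.succ * (x - y) i.succ :=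
    Finset.single_le_sum (f := fun i : Fin s => (x - y) i.succ * (x - y) i.succ)
      (fun i _ => mul_self_nonneg _) (Finset.mem_univ k)
  simp only [minkowskiForm, LinearMap.mk₂_apply]
  linarith [abs_lt_iff_mul_self_lt.1 hk]

theorem spacelikeSeparated_image_add {O₁ O₂ : Set (Fin (s + 1) → ℝ)} {R : ℝ}
    (h₁ : ∀ y ∈ O₁, ‖y‖ ≤ R) (h₂ : ∀ y ∈ O₂, ‖y‖ ≤ R) {x : Fin (s + 1) → ℝ}
    (hx : x ∉ nearRegion s (4 * R)) : SpacelikeSeparated ((fun y => y + x) '' O₁) O₂ := by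
  obtain ⟨k, hk⟩ := not_forall.1 hx
  refine spacelikeSeparated_of_abs_lt ?_
  rintro _ ⟨y, hy, rfl⟩ z hz
  have hyz : ∀ i, |y i - z i| ≤ 2 * R := fun i =>
    calc |y i - z i| ≤ |y i| + |z i| := abs_sub _ _
      _ ≤ R + R := add_le_add ((norm_le_pi_norm y i).trans (h₁ y hy))
        ((norm_le_pi_norm z i).trans (h₂ z hz))
      _ = 2 * R := (two_mul R).symm
  have heq : ∀ i, (y + x - z) i = x i + (y i - z i) := fun i => by
    simp only [Pi.add_apply, Pi.sub_apply]
    ring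
  refine ⟨k, ?_⟩
  rw [heq, heq]
  linarith [abs_add_le (x 0) (y 0 - z 0), abs_sub_abs_le_abs_add (x k.succ) (y k.succ - z k.succ),
    hyz 0, hyz k.succ, not_le.1 hk]

theorem exists_forall_commute_translation (hA : (A : H →L[ℂ] H) ∈ Q.localOperators)
    (hC : C ∈ Q.localOperators) :
    ∃ R, ∀ x ∉ nearRegion s R, Commute (Q.translation x A : H →L[ℂ] H) C := by
  obtain ⟨O₁, ho₁, hb₁, hA⟩ := hA
  obtain ⟨O₂, ho₂, hb₂, hC⟩ := hC
  obtain ⟨R, hR⟩ := (hb₁.union hb₂).exists_norm_le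
  refine ⟨4 * R, fun x hx => ?_⟩
  have hmem : (Q.translation x A : H →L[ℂ] H) ∈ Q.net ((fun y => y + x) '' O₁) := by
    rw [← SetLike.mem_coe, ← Q.covariance x O₁ ho₁ hb₁]
    exact ⟨A, hA, rfl⟩
  exact Q.locality _ _ ((Homeomorph.addRight x).isOpenMap O₁ ho₁)
    ((isometry_add_right x).lipschitz.isBounded_image hb₁) ho₂ hb₂
    (spacelikeSeparated_image_add (fun y hy => hR y (.inl hy)) (fun y hy => hR y (.inr hy)) hx)
    _ hmem _ hC

end Locality

section Average

instance : CompleteSpace Q.algebra :=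
  (StarSubalgebra.isClosed_topologicalClosure Q.localOperators).completeSpace_coe

variable {X : Type*} [TopologicalSpace X] (j : C(X, Fin (s + 1) → ℝ)) (k : C(X, Circle))

theorem norm_smul_translation (A : Q.algebra) (x : X) :
    ‖(k x : ℂ) • Q.translation (j x) A‖ = ‖A‖ := by
  rw [norm_smul, Circle.norm_coe, one_mul, LinearIsometry.norm_map]

variable [SecondCountableTopology X] [MeasurableSpace X] [OpensMeasurableSpace X]

theorem integrable_smul_translation (μ : Measure X) [IsFiniteMeasure μ] (A : Q.algebra) :
    Integrable (fun x => (k x : ℂ) • Q.translation (j x) A) μ := by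
  have hcont : Continuous fun x => (k x : ℂ) • Q.translation (j x) A :=
    (continuous_induced_dom.comp k.continuous).smul
      ((Q.translation_continuous A).comp j.continuous)
  exact .of_bound hcont.aestronglyMeasurable ‖A‖
    (.of_forall fun x => (Q.norm_smul_translation j k A x).le)

/-- The average `∫ k(x) α_{j(x)}(A) dμ(x)` of the translates of an observable. With `k` a character
and `μ` the normalized Lebesgue measure on a cuboid, its expectations are the means which define
`𝔄_c`. -/
noncomputable def average (μ : Measure X) [IsZeroOrProbabilityMeasure μ] :
    Q.algebra →L[ℂ] Q.algebra :=
  LinearMap.mkContinuous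
    { toFun A := ∫ x, (k x : ℂ) • Q.translation (j x) A ∂μ
      map_add' A A' := by
        simp only [map_add, smul_add]
        exact integral_add (Q.integrable_smul_translation j k μ A)
          (Q.integrable_smul_translation j k μ A')
      map_smul' c A := by
        simp only [map_smul, smul_comm _ c, integral_smul, RingHom.id_apply] }
    1 fun A => by
      refine (norm_integral_le_of_norm_le_const
        (.of_forall fun x => (Q.norm_smul_translation j k A x).le)).trans ?_
      rw [mul_comm]
      exact mul_le_mul_of_nonneg_right measureReal_le_one (norm_nonneg A)

variable {μ : Measure X} [IsZeroOrProbabilityMeasure μ]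

theorem norm_average_apply_le (A : Q.algebra) : ‖Q.average j k μ A‖ ≤ ‖A‖ :=
  ((Q.average j k μ).le_of_opNorm_le (LinearMap.mkContinuous_norm_le _ zero_le_one _) A).trans
    (one_mul _).le

theorem map_average {F : Type*} [NormedAddCommGroup F] [NormedSpace ℂ F] [CompleteSpace F]
    (T : Q.algebra →L[ℂ] F) (A : Q.algebra) :
    T (Q.average j k μ A) = ∫ x, (k x : ℂ) • T (Q.translation (j x) A) ∂μ := by
  simp only [← T.map_smul]
  exact (T.integral_comp_comm (Q.integrable_smul_translation j k μ A)).symm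

/-- The commutator `A ↦ A C - C A` as a bounded linear map, so that it passes under the integral of
an average. -/
noncomputable def commutatorWith (C : H →L[ℂ] H) : Q.algebra →L[ℂ] (H →L[ℂ] H) :=
  LinearMap.mkContinuous
    { toFun A := (A : H →L[ℂ] H) * C - C * (A : H →L[ℂ] H)
      map_add' A A' := by
        push_cast
        noncomm_ring
      map_smul' c A := by simp [smul_sub] }
    (2 * ‖C‖) fun A => norm_mul_sub_mul_le (A : H →L[ℂ] H) C

theorem norm_commutatorWith_apply_le (C : H →L[ℂ] H) (A : Q.algebra) :
    ‖Q.commutatorWith C A‖ ≤ 2 * ‖C‖ * ‖A‖ :=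
  norm_mul_sub_mul_le (A : H →L[ℂ] H) C

variable {ι : Type*} {l : Filter ι} {μ : ι → Measure X} [∀ i, IsZeroOrProbabilityMeasure (μ i)]

theorem tendsto_commutatorWith_average_of_mem_localOperators
    (hfar : ∀ R, Tendsto (fun i => (μ i).real (j ⁻¹' nearRegion s R)) l (𝓝 0))
    (hA : (A : H →L[ℂ] H) ∈ Q.localOperators) (hC : C ∈ Q.localOperators) :
    Tendsto (fun i => Q.commutatorWith C (Q.average j k (μ i) A)) l (𝓝 0) := by
  obtain ⟨R, hR⟩ := Q.exists_forall_commute_translation hA hC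
  refine squeeze_zero_norm (a := fun i => 2 * ‖C‖ * ‖A‖ * (μ i).real (j ⁻¹' nearRegion s R))
    (fun i => ?_) (by simpa using (hfar R).const_mul (2 * ‖C‖ * ‖A‖))
  have hzero : ∀ x ∉ j ⁻¹' nearRegion s R,
      (k x : ℂ) • Q.commutatorWith C (Q.translation (j x) A) = 0 := fun x hx => by
    rw [smul_eq_zero]
    exact .inr (sub_eq_zero.2 (hR (j x) hx))
  rw [map_average, ← setIntegral_eq_integral_of_forall_compl_eq_zero hzero]
  refine norm_setIntegral_le_of_norm_le_const (measure_lt_top _ _) fun x _ => ?_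
  rw [norm_smul, Circle.norm_coe, one_mul, ← (Q.translation (j x)).norm_map A]
  exact Q.norm_commutatorWith_apply_le C _

theorem tendsto_commutatorWith_average
    (hfar : ∀ R, Tendsto (fun i => (μ i).real (j ⁻¹' nearRegion s R)) l (𝓝 0)) (A : Q.algebra)
    (hC : C ∈ Q.localOperators) :
    Tendsto (fun i => Q.commutatorWith C (Q.average j k (μ i) A)) l (𝓝 0) := by
  have hlip : ∀ i, LipschitzWith (2 * ‖C‖₊) fun A => Q.commutatorWith C (Q.average j k (μ i) A) :=
    fun i => ((Q.commutatorWith C).comp (Q.average j k (μ i))).lipschitzWith_of_opNorm_le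
      (ContinuousLinearMap.opNorm_le_bound _ (by positivity) fun A =>
        (Q.norm_commutatorWith_apply_le C _).trans
          (mul_le_mul_of_nonneg_left (Q.norm_average_apply_le j k (μ := μ i) A) (by positivity)))
  have hdense : A ∈ closure {A : Q.algebra | (A : H →L[ℂ] H) ∈ Q.localOperators} := by
    rw [closure_subtype]
    refine closure_mono (fun B hB => ?_) A.2
    exact ⟨⟨B, subset_closure hB⟩, hB, rfl⟩
  have hequi := (LipschitzWith.uniformEquicontinuous _ _ hlip).equicontinuous
  exact (hequi.isClosed_setOfPred_tendsto continuous_const).closure_subset_iff.2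
    (fun A hA => Q.tendsto_commutatorWith_average_of_mem_localOperators j k hfar hA hC) hdense

theorem vacuumState_translation (hΩ : Q.IsVacuumVector Ω) (x : Fin (s + 1) → ℝ) (A : Q.algebra) :
    (Q.vacuumState Ω : StrongDual ℂ Q.algebra) (Q.translation x A) =
      (Q.vacuumState Ω : StrongDual ℂ Q.algebra) A := by
  have hstar : star (Q.U x : H →L[ℂ] H) Ω = Ω := by
    conv_lhs => rw [← hΩ.2 x]
    exact congr($(Unitary.star_mul_self_of_mem (Q.U x).2) Ω)
  change inner ℂ Ω ((Q.U x : H →L[ℂ] H) ((A : H →L[ℂ] H) (star (Q.U x : H →L[ℂ] H) Ω))) =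
    inner ℂ Ω ((A : H →L[ℂ] H) Ω)
  rw [hstar, ← ContinuousLinearMap.adjoint_inner_left, ← ContinuousLinearMap.star_eq_adjoint, hstar]

theorem average_mem_kerVacuum (hΩ : Q.IsVacuumVector Ω) (hA : A ∈ Q.kerVacuum Ω) (μ : Measure X)
    [IsZeroOrProbabilityMeasure μ] : Q.average j k μ A ∈ Q.kerVacuum Ω := by
  have hA' : (Q.vacuumState Ω : StrongDual ℂ Q.algebra) A = 0 := hA
  change (Q.vacuumState Ω : StrongDual ℂ Q.algebra) (Q.average j k μ A) = 0
  simp only [map_average, Q.vacuumState_translation hΩ, hA', smul_zero, integral_zero]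

theorem tendsto_apply_average_zero
    (hfar : ∀ R, Tendsto (fun i => (μ i).real (j ⁻¹' nearRegion s R)) l (𝓝 0))
    (hΩ : Q.IsVacuumVector Ω) (hA : A ∈ Q.kerVacuum Ω) (φ : Q.predual) :
    Tendsto (fun i => (φ : StrongDual ℂ Q.algebra) (Q.average j k (μ i) A)) l (𝓝 0) := by
  have hΩ0 : Ω ≠ 0 := norm_ne_zero_iff.1 (by simp [hΩ.1])
  have hirr : ActsIrreducibly Q.localOperators := .of_topologicalClosure Q.irreducible
  have hvacuum : ∀ i, inner ℂ Ω ((Q.average j k (μ i) A : H →L[ℂ] H) Ω) = 0 := fun i =>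
    Q.average_mem_kerVacuum j k hΩ hA (μ i)
  have hweak := hirr.tendsto_inner_zero (T := fun i => (Q.average j k (μ i) A : H →L[ℂ] H))
    (fun i => Q.norm_average_apply_le j k (μ := μ i) A)
    (fun C hC => Q.tendsto_commutatorWith_average j k hfar A hC) hΩ0
    (by simp [hvacuum, tendsto_const_nhds])
  simpa using tendsto_apply_of_mem_normalFunctionals φ.2 (S := 0)
    (fun i => Q.norm_average_apply_le j k (μ := μ i) A) (by simpa using hweak)

end Average

end QuantumFieldTheory

section Boxes

variable {d : ℕ}

theorem volume_real_Icc_neg_self {l : Fin d → ℝ} (hl : ∀ i, 0 ≤ l i) :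
    (volume : Measure (Fin d → ℝ)).real (Set.Icc (-l) l) = ∏ i, 2 * l i := by
  have hle : -l ≤ l := fun i => (neg_nonpos.2 (hl i)).trans (hl i)
  simp only [measureReal_def, Real.volume_Icc_pi_toReal hle, Pi.neg_apply, sub_neg_eq_add, two_mul]

theorem cond_Icc_neg_self_real_le {l r : Fin d → ℝ} (hl : ∀ i, 0 ≤ l i) (hr : ∀ i, 0 ≤ r i)
    {S : Set (Fin d → ℝ)} (h : Set.Icc (-l) l ∩ S ⊆ Set.Icc (-r) r) :
    (ProbabilityTheory.cond volume (Set.Icc (-l) l)).real S ≤ ∏ i, r i / l i :=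
  calc (ProbabilityTheory.cond volume (Set.Icc (-l) l)).real S
      = (volume.real (Set.Icc (-l) l))⁻¹ * volume.real (Set.Icc (-l) l ∩ S) := by
        simp only [measureReal_def, ProbabilityTheory.cond_apply measurableSet_Icc,
          ENNReal.toReal_mul, ENNReal.toReal_inv]
    _ ≤ (volume.real (Set.Icc (-l) l))⁻¹ * volume.real (Set.Icc (-r) r) := by
        gcongr
        exact isCompact_Icc.measure_ne_top
    _ = ∏ i, r i / l i := by
        rw [volume_real_Icc_neg_self hl, volume_real_Icc_neg_self hr, inv_mul_eq_div,
          ← Finset.prod_div_distrib]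
        simp only [mul_div_mul_left _ _ (two_ne_zero' ℝ)]

theorem mem_Icc_neg_self_iff {l x : Fin d → ℝ} : x ∈ Set.Icc (-l) l ↔ ∀ i, |x i| ≤ l i := by
  simp only [Set.mem_Icc, Pi.le_def, Pi.neg_apply, abs_le, forall_and]

end Boxes

section Minkowski

variable {s : ℕ}

theorem tendsto_rpow_add_div_atTop {ε : ℝ} (hε : ε < 1) (R : ℝ) :
    Tendsto (fun L : ℝ => (L ^ ε + R) / L) atTop (𝓝 0) := by
  have hlim : Tendsto (fun L : ℝ => L ^ (-(1 - ε)) + R / L) atTop (𝓝 0) := by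
    simpa using (tendsto_rpow_neg_atTop (sub_pos.2 hε)).add
      (tendsto_const_nhds.div_atTop tendsto_id : Tendsto (fun L : ℝ => R / L) atTop (𝓝 0))
  refine hlim.congr' ?_
  filter_upwards [eventually_gt_atTop 0] with L hL
  rw [add_div, neg_sub, Real.rpow_sub hL, Real.rpow_one]

theorem spacetimeEdges_pos (s : ℕ) (ε : ℝ) {L : ℝ} (hL : 0 < L) (i : Fin (s + 1)) :
    0 < spacetimeEdges s ε L i := by
  refine Fin.cases ?_ (fun _ => ?_) i
  · exact Real.rpow_pos_of_pos hL ε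
  · exact hL

theorem tendsto_cond_spacetimeEdges_nearRegion (hs : 1 ≤ s) {ε : ℝ} (hε : ε < 1) (R : ℝ) :
    Tendsto (fun L => (ProbabilityTheory.cond volume
      (Set.Icc (-spacetimeEdges s ε L) (spacetimeEdges s ε L))).real
        (QuantumFieldTheory.nearRegion s R)) atTop (𝓝 0) := by
  have hlim := (tendsto_rpow_add_div_atTop hε |R|).pow s
  rw [zero_pow (Nat.one_le_iff_ne_zero.1 hs)] at hlim
  refine squeeze_zero' (.of_forall fun L => measureReal_nonneg) ?_ hlim
  filter_upwards [eventually_gt_atTop 0] with L hL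
  have hLε : 0 < L ^ ε := Real.rpow_pos_of_pos hL ε
  let r : Fin (s + 1) → ℝ := Fin.cons (L ^ ε) fun _ => L ^ ε + |R|
  have hr : ∀ i, 0 ≤ r i := Fin.cases hLε.le fun k => by
    simp only [r, Fin.cons_succ]
    positivity
  refine (cond_Icc_neg_self_real_le (r := r) (fun i => (spacetimeEdges_pos s ε hL i).le) hr
    ?_).trans_eq ?_
  · rintro x ⟨hx, hnear⟩
    rw [mem_Icc_neg_self_iff] at hx ⊢
    exact Fin.cases (hx 0) fun k => (hnear k).trans (add_le_add (hx 0) (le_abs_self R))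
  · rw [Fin.prod_univ_succ]
    simp [r, spacetimeEdges, div_self hLε.ne', div_pow]

theorem tendsto_cond_spaceEdges_nearRegion (hs : 1 ≤ s) (R : ℝ) :
    Tendsto (fun L => (ProbabilityTheory.cond volume
      (Set.Icc (-spaceEdges s L) (spaceEdges s L))).real
        (spaceEmbedding s ⁻¹' QuantumFieldTheory.nearRegion s R)) atTop (𝓝 0) := by
  have hlim : Tendsto (fun L : ℝ => (|R| / L) ^ s) atTop (𝓝 (0 ^ s)) :=
    (tendsto_const_nhds.div_atTop tendsto_id).pow s
  rw [zero_pow (Nat.one_le_iff_ne_zero.1 hs)] at hlim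
  refine squeeze_zero' (.of_forall fun L => measureReal_nonneg) ?_ hlim
  filter_upwards [eventually_gt_atTop 0] with L hL
  refine (cond_Icc_neg_self_real_le (r := fun _ => |R|) (fun _ => hL.le) (fun _ => abs_nonneg R)
    ?_).trans_eq (by simp [div_pow])
  rintro x ⟨-, hnear⟩
  rw [mem_Icc_neg_self_iff]
  intro k
  have hk : |x k| ≤ R := by simpa [spaceEmbedding] using hnear k
  exact hk.trans (le_abs_self R)

theorem minkowskiForm_separatingRight (s : ℕ) : (minkowskiForm s).SeparatingRight := by
  refine fun x hx => funext fun i => ?_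
  have h := hx (Pi.single i 1)
  simp only [minkowskiForm, LinearMap.mk₂_apply] at h
  induction i using Fin.cases with
  | zero => simpa [Pi.single_apply, Fin.succ_ne_zero] using h
  | succ k => simpa [Pi.single_apply, (Fin.succ_ne_zero _).symm] using h

theorem spaceForm_separatingRight (s : ℕ) : (spaceForm s).SeparatingRight := by
  refine fun x hx => funext fun i => ?_
  simpa [spaceForm, Pi.single_apply] using hx (Pi.single i 1)

end Minkowski

namespace QuantumFieldTheory

variable {s d : ℕ} {H : Type*} [NormedAddCommGroup H] [InnerProductSpace ℂ H] [CompleteSpace H]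
  (Q : QuantumFieldTheory s H) {Ω : H} (j : (Fin d → ℝ) →ₗ[ℝ] (Fin (s + 1) → ℝ))
  {B : LinearMap.BilinForm ℝ (Fin d → ℝ)} {l : ℝ → Fin d → ℝ}

theorem kerVacuum_le_continuousSubspace
    (hfar : ∀ R, Tendsto (fun L => (ProbabilityTheory.cond volume (Set.Icc (-l L) (l L))).real
      (j ⁻¹' nearRegion s R)) atTop (𝓝 0)) (hΩ : Q.IsVacuumVector Ω) :
    Q.kerVacuum Ω ≤ (Q.spacetimeTranslations.restrict j).continuousSubspace B l := by
  intro A hA q φ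
  let character : C(Fin d → ℝ, Circle) :=
    ⟨fun x => Circle.exp (-B q x), by
      have := (B q).continuous_of_finiteDimensional
      fun_prop⟩
  refine (Q.tendsto_apply_average_zero ⟨j, j.continuous_of_finiteDimensional⟩ character hfar hΩ hA
    φ).congr fun L => ?_
  rw [IsometryGroup.mean_eq_integral_cond, map_average]
  refine integral_congr_ae (.of_forall fun x => ?_)
  have hexp : (character x : ℂ) = Complex.exp (-Complex.I * (B q x : ℝ)) := by
    simp [character, mul_comm, Complex.exp_neg]
  exact congrArg (· * (φ : StrongDual ℂ Q.algebra) (Q.translation (j x) A)) hexp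

theorem invariantPair_one_vacuumState (hΩ : Q.IsVacuumVector Ω) :
    IsometryGroup.InvariantPair (Q.spacetimeTranslations.restrict j) 1 (Q.vacuumState Ω) where
  pairing_act_vector φ x := by
    have hone : Q.translation (j x) 1 = 1 := by
      ext1
      simp [translation]
    exact congrArg (φ : StrongDual ℂ Q.algebra) hone
  pairing_act_functional A x := Q.vacuumState_translation hΩ (j x) A
  pairing_eq_one := by
    change inner ℂ Ω Ω = (1 : ℂ)
    rw [inner_self_eq_norm_sq_to_K, hΩ.1]
    simp

theorem eq_zero_of_forall_predual {A : Q.algebra}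
    (h : ∀ φ : Q.predual, (φ : StrongDual ℂ Q.algebra) A = 0) : A = 0 := by
  have hinner : ∀ v, inner ℂ (((A : H →L[ℂ] H) : H →ₗ[ℂ] H) v) v = (0 : ℂ) := fun v =>
    inner_eq_zero_symm.1 (h (Q.vacuumState v))
  ext v
  exact congr($((inner_map_self_eq_zero _).1 hinner) v)

theorem pairing_nondegenerate : (Q.spacetimeTranslations.restrict j).pairing.Nondegenerate :=
  ⟨fun _ h => Subtype.ext (ContinuousLinearMap.ext h), fun _ h => Q.eq_zero_of_forall_predual h⟩

theorem spectral_decomposition (hΩ : Q.IsVacuumVector Ω) (hB : B.SeparatingRight)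
    (hl : ∀ᶠ L in atTop, ∀ i, 0 < l L i)
    (hfar : ∀ R, Tendsto (fun L => (ProbabilityTheory.cond volume (Set.Icc (-l L) (l L))).real
      (j ⁻¹' nearRegion s R)) atTop (𝓝 0)) :
    Q.kerVacuum Ω ≤ (Q.spacetimeTranslations.restrict j).continuousSubspace B l ∧
      (IsCompl ((Q.spacetimeTranslations.restrict j).purePointSubspace B)
          ((Q.spacetimeTranslations.restrict j).continuousSubspace B l) ∧
        (Q.spacetimeTranslations.restrict j).purePointSubspace B = Submodule.span ℂ {1} ∧
        (Q.spacetimeTranslations.restrict j).continuousSubspace B l = Q.kerVacuum Ω) ∧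
      (IsCompl ((Q.dualSpacetimeTranslations.restrict j).purePointSubspace B)
          ((Q.dualSpacetimeTranslations.restrict j).continuousSubspace B l) ∧
        (Q.dualSpacetimeTranslations.restrict j).purePointSubspace B =
          Submodule.span ℂ {Q.vacuumState Ω} ∧
        (Q.dualSpacetimeTranslations.restrict j).continuousSubspace B l = Q.kerUnit) ∧
      (Q.spacetimeTranslations.restrict j).continuousSpectrum B l =
        (Q.dualSpacetimeTranslations.restrict j).continuousSpectrum B l :=
  have hker : Q.kerVacuum Ω ≤ (Q.spacetimeTranslations.restrict j).continuousSubspace B l :=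
    Q.kerVacuum_le_continuousSubspace j hfar hΩ
  ⟨hker, (Q.invariantPair_one_vacuumState j hΩ).spectral_decomposition (fun _ _ _ => rfl) hB
    (Q.pairing_nondegenerate j) hl hker⟩

end QuantumFieldTheory

theorem mainTheorem5 {s : ℕ} (hs : 1 ≤ s) {H : Type*} [NormedAddCommGroup H]
    [InnerProductSpace ℂ H] [CompleteSpace H] (Q : QuantumFieldTheory s H)
    (Ω : H) (hΩ : Q.IsVacuumVector Ω) (ε : ℝ) (hε₀ : 0 < ε) (hε₁ : ε < 1) :
    (Q.kerVacuum Ω ≤ Q.spacetimeTranslations.continuousSubspace (minkowskiForm s) (spacetimeEdges s ε) ∧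
      (IsCompl (Q.spacetimeTranslations.purePointSubspace (minkowskiForm s))
          (Q.spacetimeTranslations.continuousSubspace (minkowskiForm s) (spacetimeEdges s ε)) ∧
        Q.spacetimeTranslations.purePointSubspace (minkowskiForm s) = Submodule.span ℂ {1} ∧
        Q.spacetimeTranslations.continuousSubspace (minkowskiForm s) (spacetimeEdges s ε) = Q.kerVacuum Ω) ∧
      (IsCompl (Q.dualSpacetimeTranslations.purePointSubspace (minkowskiForm s))
          (Q.dualSpacetimeTranslations.continuousSubspace (minkowskiForm s) (spacetimeEdges s ε)) ∧
        Q.dualSpacetimeTranslations.purePointSubspace (minkowskiForm s) = Submodule.span ℂ {Q.vacuumState Ω} ∧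
        Q.dualSpacetimeTranslations.continuousSubspace (minkowskiForm s) (spacetimeEdges s ε) = Q.kerUnit) ∧
      Q.spacetimeTranslations.continuousSpectrum (minkowskiForm s) (spacetimeEdges s ε) =
        Q.dualSpacetimeTranslations.continuousSpectrum (minkowskiForm s) (spacetimeEdges s ε)) ∧
    (Q.kerVacuum Ω ≤ Q.spaceTranslations.continuousSubspace (spaceForm s) (spaceEdges s) ∧
      (IsCompl (Q.spaceTranslations.purePointSubspace (spaceForm s))
          (Q.spaceTranslations.continuousSubspace (spaceForm s) (spaceEdges s)) ∧
        Q.spaceTranslations.purePointSubspace (spaceForm s) = Submodule.span ℂ {1} ∧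
        Q.spaceTranslations.continuousSubspace (spaceForm s) (spaceEdges s) = Q.kerVacuum Ω) ∧
      (IsCompl (Q.dualSpaceTranslations.purePointSubspace (spaceForm s))
          (Q.dualSpaceTranslations.continuousSubspace (spaceForm s) (spaceEdges s)) ∧
        Q.dualSpaceTranslations.purePointSubspace (spaceForm s) = Submodule.span ℂ {Q.vacuumState Ω} ∧
        Q.dualSpaceTranslations.continuousSubspace (spaceForm s) (spaceEdges s) = Q.kerUnit) ∧
      Q.spaceTranslations.continuousSpectrum (spaceForm s) (spaceEdges s) =
        Q.dualSpaceTranslations.continuousSpectrum (spaceForm s) (spaceEdges s)) := by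
  have hposSpacetime : ∀ᶠ L in atTop, ∀ i, 0 < spacetimeEdges s ε L i :=
    (eventually_gt_atTop 0).mono fun L hL => spacetimeEdges_pos s ε hL
  have hposSpace : ∀ᶠ L in atTop, ∀ i, 0 < spaceEdges s L i :=
    (eventually_gt_atTop 0).mono fun L hL _ => hL
  exact ⟨Q.spectral_decomposition LinearMap.id hΩ (minkowskiForm_separatingRight s) hposSpacetime
      (tendsto_cond_spacetimeEdges_nearRegion hs hε₁),
    Q.spectral_decomposition (spaceEmbedding s) hΩ (spaceForm_separatingRight s) hposSpace
      (tendsto_cond_spaceEdges_nearRegion hs)⟩
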